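/- **Setting.** Let $\{\nu_a : a\in J\}$ be a nondegenerate one-parameter exponential family on $\mathbb R$ (densities proportional to $e^{\theta x}$ with respect to a reference measure that is not concentrated at one point, $\theta$ in an open interval on which these functions are integrable), parameterized by its means $a\in J$; examples are the Bernoulli and the Poisson distributions. Let $d(a,b)$ be the Kullback–Leibler divergence of $\nu_a$ from $\nu_b$, and $d_B$ that of Bernoulli distributions. Fix $K\ge1$ and a threshold $\gamma\in J$. Slice $k\in\{1,\dots,K\}$ has load $\mu_k\in J$; the measurements $X_k(t)$, $t\ge1$, of slice $k$ are i.i.d. with law $\nu_{\mu_k}$, independently over slices. Slice $k$ is available if $\mu_k<\gamma$; if some slice is available, let $k^\star\in\arg\max_{k:\mu_k<\gamma}\mu_k$ and $\mu^\star=\mu_{k^\star}$. Let $\mathcal M$ be the set of $\mu\in J^K$ such that $\mu_k\ne\gamma$ for all $k$ and $k^\star$ is unique whenever some slice is available. For the packing-slice criterion the set of correct answers is $\mathcal C(\mu)=\{k^\star\}$ if some slice is available, and $\mathcal C(\mu)=\{0\}$ otherwise. An algorithm measures in each slot $t$ one slice $k_t$ that is $\mathcal F_{t-1}$-measurable, where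 $\mathcal F_t=\sigma(k_1,X_{k_1}(1),\dots,k_t,X_{k_t}(t))$, stops at a stopping time $\tau$ of $(\mathcal F_t)$ and returns an $\mathcal F_\tau$-measurable $\hat k\in\{0,\dots,K\}$. It is $\delta$-PC if $\mathbb P_\mu[\tau<\infty]=1$ and $\mathbb P_\mu[\hat k\notin\mathcal C(\mu)]\le\delta$ for every $\mu\in\mathcal M$. For $x\ge0$ let $$g_{j,k}(x)=d\Big(\mu_k,\tfrac{\mu_k+x\mu_j}{1+x}\Big)+x\,d\Big(\mu_j,\tfrac{\mu_k+x\mu_j}{1+x}\Big),$$ let $x_{j,k}=g_{j,k}^{-1}$, defined on $g_{j,k}([0,\infty))$, with the convention $x_{k,k}\equiv1$, and for a set $S$ of slices let $$F_k(y;S)=\sum_{j\in S}\frac{d\big(\mu_k,(\mu_k+x_{j,k}(y)\mu_j)/(1+x_{j,k}(y))\big)}{d\big(\mu_j,(\mu_k+x_{j,k}(y)\mu_j)/(1+x_{j,k}(y))\big)} .$$ **Proposition 3 (packing slice).** Let $\mu\in\mathcal M$ have an available slice, and let $\mathcal S_P=\{j:\mu_j<\mu^\star\}$. 1. If $\mathcal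 S_P\neq\emptyset$, the equation $F_{k^\star}(y;\mathcal S_P)=1$ has exactly one solution $y^\star$ in the common domain of the functions $x_{j,k^\star}$, $j\in\mathcal S_P$; if $\mathcal S_P=\emptyset$, set $y^\star=\infty$. The number $z^\star=\min(d(\mu^\star,\gamma),y^\star)$ is positive and lies in the domain of $x_{j,k^\star}$ for every $j\in\mathcal S_P$. 2. For every $0<\delta\le\frac12$, every $\delta$-PC algorithm satisfies $\mathbb E_\mu[\tau]\ge T_2(\mu)\,d_B(\delta,1-\delta)$, where $$T_2(\mu)=\sum_{k:\mu_k>\mu^\star}d(\mu_k,\gamma)^{-1}+\frac1{z^\star}\sum_{k:\mu_k<\gamma}x_{k,k^\star}(z^\star).$$ 3. The optimal measurement proportions are $$w^\star_k(\mu)=\frac1{T_2(\mu)}\left(\frac{x_{k,k^\star}(z^\star)\mathbf 1_{(\mu_k<\gamma)}}{z^\star}+\frac{\mathbf 1_{(\mu_k>\gamma)}}{d(\mu_k,\gamma)}\right),\qquad k=1,\dots,K;$$ that is, $w^\star(\mu)$ is the unique maximizer of $$w\mapsto\inf_{\lambda\in\mathcal M:\,k^\star\notin\mathcal C(\lambda)}\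 \sum_{k=1}^K w_k\,d(\mu_k,\lambda_k)$$ over the simplex $\{w\in[0,1]^K:\sum_kw_k=1\}$, and the maximum is $T_2(\mu)^{-1}$. -/

import Mathlib

open MeasureTheory ProbabilityTheory Set
open scoped ENNReal

noncomputable section

namespace Slicing

/-! ### One-parameter exponential families, parameterized by the mean -/

/-- A nondegenerate one-parameter (natural) exponential family on `ℝ`: the distributions with
density proportional to `x ↦ exp (θ * x)` with respect to a reference measure, where `θ` ranges
over an open interval on which `x ↦ exp (θ * x)` is integrable. Poisson and Bernoulli
distributions are of this form, with `Θ = ℝ`. -/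
structure ExpFamily where
  /-- the reference measure -/
  ref : Measure ℝ
  /-- the set of natural parameters -/
  Θ : Set ℝ
  isOpen_Θ : IsOpen Θ
  ordConnected_Θ : Θ.OrdConnected
  integrable_exp : ∀ θ ∈ Θ, Integrable (fun x => Real.exp (θ * x)) ref
  /-- the reference measure is not concentrated at a single point -/
  nondegenerate : ∀ c : ℝ, ref {c}ᶜ ≠ 0

namespace ExpFamily

variable (E : ExpFamily)

/-- The member of the family with natural parameter `θ`. -/
def natLaw (θ : ℝ) : Measure ℝ := E.ref.tilted (fun x => θ * x)

/-- The mean of the member with natural parameter `θ`. -/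
def mean (θ : ℝ) : ℝ := ∫ x, x ∂(E.natLaw θ)

/-- The set of means of the members of the family. -/
def means : Set ℝ := E.mean '' E.Θ

/-- The member of the family whose mean is `a`, for `a ∈ E.means`. -/
def law (a : ℝ) : Measure ℝ := E.natLaw (Function.invFunOn E.mean E.Θ a)

/-- The Kullback-Leibler divergence `d(a, b)` between the members with means `a` and `b`. -/
def d (a b : ℝ) : ℝ := (InformationTheory.klDiv (E.law a) (E.law b)).toReal

end ExpFamily

/-- The Kullback-Leibler divergence `d_B(a, b)` between the Bernoulli distributions with
means `a` and `b`, for `a, b ∈ (0, 1)`. -/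
def dB (a b : ℝ) : ℝ := a * Real.log (a / b) + (1 - a) * Real.log ((1 - a) / (1 - b))

/-! ### The packing-slice criterion -/

section Criterion

variable {K : ℕ}

/-- `k` is a most loaded slice among the available ones (those with load below `γ`). -/
def IsPackingSlice (γ : ℝ) (μ : Fin K → ℝ) (k : Fin K) : Prop :=
  μ k < γ ∧ ∀ j, μ j < γ → μ j ≤ μ k

/-- The set `C(μ) ⊆ {0, …, K}` of correct answers: `0` means rejection, and `k.succ` means that
slice `k` is selected. -/
def correct (γ : ℝ) (μ : Fin K → ℝ) : Set (Fin (K + 1)) :=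
  {a | (a = 0 ∧ ∀ k, γ ≤ μ k) ∨ ∃ k, a = k.succ ∧ IsPackingSlice γ μ k}

/-- The load vectors under consideration: the loads are means of members of the family, no load
equals the threshold, and the most loaded available slice is unique if there is an available
slice. -/
def instances (E : ExpFamily) (γ : ℝ) : Set (Fin K → ℝ) :=
  {μ | (∀ k, μ k ∈ E.means) ∧ (∀ k, μ k ≠ γ) ∧
    ∀ j k, IsPackingSlice γ μ j → IsPackingSlice γ μ k → j = k}

end Criterion

/-! ### Algorithms -/

section Algorithms

/-- Measurements: `ω t k` is the number of packets that slice `k` handles in slot `t + 1`. -/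
abbrev Obs (K : ℕ) : Type := ℕ → Fin K → ℝ

variable {K : ℕ}

/-- The law `P_μ` of the measurements: all `ω t k` are independent, and `ω t k` has the law of
the family with mean `μ k`. -/
def obsLaw (E : ExpFamily) (μ : Fin K → ℝ) : Measure (Obs K) :=
  Measure.infinitePi (fun _ : ℕ => Measure.pi (fun k => E.law (μ k)))

/-- The σ-algebra generated by the slices measured in the first `t` slots and by the values
observed there; `arm s` is the slice measured in slot `s + 1`. -/
@[reducible]
def history (arm : ℕ → Obs K → Fin K) (t : ℕ) : MeasurableSpace (Obs K) :=
  ⨆ s ∈ Set.Iio t, (MeasurableSpace.comap (arm s) ⊤ ⊔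
    MeasurableSpace.comap (fun ω : Obs K => ω s (arm s ω)) (borel ℝ))

/-- A sampling strategy: the slice measured in a slot depends on the past observations only. -/
structure SamplingRule (K : ℕ) where
  /-- `arm t` is the slice measured in slot `t + 1` -/
  arm : ℕ → Obs K → Fin K
  adapted : ∀ t, Measurable[history arm t, ⊤] (arm t)

theorem history_mono (arm : ℕ → Obs K → Fin K) : Monotone (history arm) :=
  fun _ _ h => biSup_mono fun _ hs => lt_of_lt_of_le hs h

theorem history_le_of_measurable (arm : ℕ → Obs K → Fin K) (t : ℕ)
    (h : ∀ s < t, Measurable (arm s)) : history arm t ≤ MeasurableSpace.pi := by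
  refine iSup₂_le fun s hs => sup_le (h s hs).comap_le ?_
  rw [← (inferInstance : BorelSpace ℝ).measurable_eq]
  refine Measurable.comap_le ?_
  refine (measurable_from_prod_countable_left (f := fun p : Obs K × Fin K => p.1 s p.2)
    (fun k => ?_)).comp (measurable_id.prodMk (h s hs))
  exact (measurable_pi_apply k).comp (measurable_pi_apply s)

theorem SamplingRule.measurable_arm (S : SamplingRule K) (t : ℕ) : Measurable (S.arm t) := by
  induction t using Nat.strong_induction_on with
  | _ t ih => exact (S.adapted t).mono (history_le_of_measurable S.arm t ih) le_rfl

/-- The filtration generated by the observations. -/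
def SamplingRule.filtration (S : SamplingRule K) :
    Filtration ℕ (MeasurableSpace.pi : MeasurableSpace (Obs K)) where
  seq := history S.arm
  mono' := history_mono S.arm
  le' := fun t => history_le_of_measurable S.arm t fun s _ => S.measurable_arm s

/-- A joint measurement and decision algorithm: a sampling rule, a stopping time for the
filtration of the observations, and a decision that is measurable at the stopping time. -/
structure Algorithm (K : ℕ) extends SamplingRule K where
  /-- the stopping time -/
  τ : Obs K → ℕ∞
  isStoppingTime : IsStoppingTime toSamplingRule.filtration τ
  /-- the returned decision in `{0, …, K}` -/
  decision : Obs K → Fin (K + 1)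
  measurable_decision : Measurable[isStoppingTime.measurableSpace, ⊤] decision

/-- For every admissible load vector, the algorithm stops almost surely and its decision is wrong
with probability at most `δ`. -/
def Algorithm.IsPC (A : Algorithm K) (E : ExpFamily) (γ δ : ℝ) : Prop :=
  ∀ μ ∈ instances E γ, (∀ᵐ ω ∂(obsLaw E μ), A.τ ω < ⊤) ∧
    obsLaw E μ {ω | A.decision ω ∉ correct γ μ} ≤ ENNReal.ofReal δ

/-- The expected number of measurements `E_μ[τ]`. -/
def Algorithm.expectedTime (A : Algorithm K) (E : ExpFamily) (μ : Fin K → ℝ) : ℝ≥0∞ :=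
  ∫⁻ ω, (A.τ ω : ℝ≥0∞) ∂(obsLaw E μ)

end Algorithms

/-! ### The characteristic time and the optimal proportions -/

section Bound

variable {K : ℕ} (E : ExpFamily) (γ : ℝ) (μ : Fin K → ℝ)

/-- The weighted mean `(μ_k + x μ_j) / (1 + x)`. -/
def mix (j k : Fin K) (x : ℝ) : ℝ := (μ k + x * μ j) / (1 + x)

/-- The information deviation function `g_{j,k}` on `[0, ∞)`. -/
def g (j k : Fin K) (x : ℝ) : ℝ :=
  E.d (μ k) (mix μ j k x) + x * E.d (μ j) (mix μ j k x)

/-- The range of `g_{j,k}`, which is the domain of its inverse. -/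
def gRange (j k : Fin K) : Set ℝ := g E μ j k '' Set.Ici 0

/-- The inverse `x_{j,k}` of `g_{j,k} : [0, ∞) → ℝ`, with the convention `x_{k,k} = 1`. -/
def xInv (j k : Fin K) (y : ℝ) : ℝ :=
  if j = k then 1 else Function.invFunOn (g E μ j k) (Set.Ici 0) y

/-- The equilibrium function `F_k(y; S)`. -/
def F (k : Fin K) (S : Finset (Fin K)) (y : ℝ) : ℝ :=
  ∑ j ∈ S, E.d (μ k) (mix μ j k (xInv E μ j k y)) / E.d (μ j) (mix μ j k (xInv E μ j k y))

/-- The slices that are less loaded than slice `k`. -/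
def lessLoaded (k : Fin K) : Finset (Fin K) := {j | μ j < μ k}

/-- `y` solves `F_k(y; S) = 1` for the set `S` of the slices less loaded than `k`, where `y` lies
in the domain of `F_k(·; S)`. -/
def IsEquilibrium (k : Fin K) (y : ℝ) : Prop :=
  (∀ j ∈ lessLoaded μ k, y ∈ gRange E μ j k) ∧ F E μ k (lessLoaded μ k) y = 1

/-- The solution `y*` of the equilibrium equation. -/
def yStar (k : Fin K) : ℝ := Classical.epsilon (IsEquilibrium E μ k)

/-- `z* = min (d(μ_k, γ), y*)`. If no slice is less loaded than `k`, then the equilibrium function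
vanishes, `y*` is read as `∞`, and `z* = d(μ_k, γ)`. -/
def zStar (k : Fin K) : ℝ :=
  if (lessLoaded μ k).Nonempty then min (E.d (μ k) γ) (yStar E μ k) else E.d (μ k) γ

/-- The characteristic time `T₂(μ)`, where `k` is the packing slice. -/
def T2 (k : Fin K) : ℝ :=
  ∑ j with μ j > μ k, (E.d (μ j) γ)⁻¹ +
    1 / zStar E γ μ k * ∑ j with μ j < γ, xInv E μ j k (zStar E γ μ k)

/-- The measurement proportions `w*(μ)`, where `k` is the packing slice. -/
def wStar (k j : Fin K) : ℝ :=
  1 / T2 E γ μ k *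
    ((if μ j < γ then xInv E μ j k (zStar E γ μ k) / zStar E γ μ k else 0) +
      (if μ j > γ then 1 / E.d (μ j) γ else 0))

/-- The load vectors for which the answer `a` is not correct. -/
def alt (a : Fin (K + 1)) : Set (Fin K → ℝ) := {ν | ν ∈ instances E γ ∧ a ∉ correct γ ν}

/-- The information rate `inf_{ν ∈ Alt(a)} ∑_j w_j d(μ_j, ν_j)` of the proportions `w`. -/
def rate (a : Fin (K + 1)) (w : Fin K → ℝ) : ℝ :=
  sInf ((fun ν : Fin K → ℝ => ∑ j, w j * E.d (μ j) (ν j)) '' alt E γ a)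

end Bound

end Slicing

end

/-!
The compensation identity says that a positive combination `a * d x m + b * d y m` is minimised
exactly when `m` is the weighted mean of `x` and `y`. Hence measuring slice `k` and a less loaded
slice `j` in the ratio `1 : x` collects the information `g_{j,k} x` against the alternatives that
exchange their order, and the cheapest way to collect one unit of information against every
alternative is the solution of a linear program: with `m_j` the weighted mean at `x = x_{j,k} z*`,
the counts `w` satisfy `w_k d(μ_k, m_j) + w_j d(μ_j, m_j) ≥ 1` for `j` less loaded than `k`,
`w_k d(μ_k, γ) ≥ 1`, and `w_j d(μ_j, γ) ≥ 1` for `j` above `γ`. The constraint of a less loaded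
slice `j` has the multiplier `1 / d(μ_j, m_j)`, which takes up the summand of `F_k` at `j` from the
unit budget of slice `k`. If `z* = y*` this exhausts the budget, because `F_k y* = 1`; otherwise the
remainder `1 - F_k` goes to the constraint on `d(μ_k, γ)`, which is then tight. Weak duality gives
the value `T₂`, and complementary slackness the uniqueness of `w*`.

For the lower bound, evaluate the log-likelihood ratio of `μ` against an alternative at the bounded
time `min τ n`. The inequality `e^u ≥ 1 + u` bounds its mean below in terms of the probability of a
correct decision by time `n`, and Wald's identity writes this mean as the information collected by
the expected measurement counts. So these counts are, up to scaling, feasible for the linear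
program, and `n → ∞` gives the claim.
-/

open MeasureTheory ProbabilityTheory Set
open scoped ENNReal

noncomputable section

namespace Slicing

/-! ### Divergence in exponential families -/

theorem continuousOn_invFunOn_image {α β : Type*} [ConditionallyCompleteLinearOrder α]
    [DenselyOrdered α] [TopologicalSpace α] [OrderTopology α] [Nonempty α] [LinearOrder β]
    [TopologicalSpace β] [OrderTopology β] {f : α → β} {s : Set α} (hs : s.OrdConnected)
    (hf : StrictMonoOn f s) (hc : ContinuousOn f s) :
    ContinuousOn (Function.invFunOn f s) (f '' s) := by
  have image_ordConnected : (f '' s).OrdConnected :=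
    (hs.isPreconnected.image f hc).ordConnected
  have continuous_symm : Continuous fun y : f '' s => (((hf.orderIso f s).symm y : s) : α) :=
    continuous_subtype_val.comp (hf.orderIso f s).symm.continuous
  rw [continuousOn_iff_continuous_domRestrict]
  convert continuous_symm using 1
  ext y
  obtain ⟨x, rfl⟩ := (hf.orderIso f s).surjective y
  rw [OrderIso.symm_apply_apply]
  exact hf.injOn.leftInvOn_invFunOn x.2

namespace ExpFamily

variable (E : ExpFamily)

/-- The log-partition function of the family, i.e. the cumulant generating function of the
reference measure. -/
def logPartition (θ : ℝ) : ℝ := cgf id E.ref θ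

/-- The log-density of the member with natural parameter `t` with respect to the one with natural
parameter `θ`. -/
def logDensity (θ t x : ℝ) : ℝ := (t - θ) * x - (E.logPartition t - E.logPartition θ)

/-- The natural parameter of the member of the family with mean `a`. -/
def natParam (a : ℝ) : ℝ := Function.invFunOn E.mean E.Θ a

/-- The log-density of the member with mean `b` with respect to the one with mean `a`. -/
def logRatio (a b x : ℝ) : ℝ := E.logDensity (E.natParam a) (E.natParam b) x

instance neZero_ref : NeZero E.ref := ⟨fun h => E.nondegenerate 0 (by simp [h])⟩

variable {E} {θ t s a b c : ℝ}

section NaturalParameter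

theorem mem_interior_integrableExpSet (hθ : θ ∈ E.Θ) :
    θ ∈ interior (integrableExpSet id E.ref) :=
  interior_maximal E.integrable_exp E.isOpen_Θ hθ

theorem isProbabilityMeasure_natLaw (hθ : θ ∈ E.Θ) : IsProbabilityMeasure (E.natLaw θ) :=
  isProbabilityMeasure_tilted (E.integrable_exp θ hθ)

theorem integrable_id_natLaw (hθ : θ ∈ E.Θ) : Integrable (fun x => x) (E.natLaw θ) :=
  (memLp_one_iff_integrable (f := id)).1
    (by simpa using! memLp_tilted_mul (mem_interior_integrableExpSet hθ) 1)

theorem exp_logPartition (hθ : θ ∈ E.Θ) :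
    Real.exp (E.logPartition θ) = ∫ x, Real.exp (θ * x) ∂E.ref :=
  exp_cgf (X := id) (E.integrable_exp θ hθ)

theorem tilted_natLaw (hθ : θ ∈ E.Θ) (t : ℝ) :
    (E.natLaw θ).tilted (fun x => (t - θ) * x) = E.natLaw t := by
  rw [natLaw, tilted_tilted (E.integrable_exp θ hθ), natLaw]
  congr 1
  ext x
  simp only [Pi.add_apply]
  ring

theorem integral_exp_natLaw (hθ : θ ∈ E.Θ) (ht : t ∈ E.Θ) :
    ∫ x, Real.exp ((t - θ) * x) ∂(E.natLaw θ)
      = Real.exp (E.logPartition t - E.logPartition θ) := by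
  rw [natLaw, integral_exp_tilted (fun x => θ * x) (fun x => (t - θ) * x), Real.exp_sub,
    exp_logPartition hθ, exp_logPartition ht]
  simp only [Pi.add_apply, ← add_mul, add_sub_cancel]

theorem integrable_exp_natLaw (hθ : θ ∈ E.Θ) (ht : t ∈ E.Θ) :
    Integrable (fun x => Real.exp ((t - θ) * x)) (E.natLaw θ) :=
  Integrable.of_integral_ne_zero (by rw [integral_exp_natLaw hθ ht]; positivity)

theorem natLaw_eq_withDensity (hθ : θ ∈ E.Θ) (ht : t ∈ E.Θ) :
    E.natLaw t = (E.natLaw θ).withDensity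
      fun x => ENNReal.ofReal (Real.exp (E.logDensity θ t x)) := by
  simp only [← tilted_natLaw hθ t, Measure.tilted, integral_exp_natLaw hθ ht, logDensity,
    Real.exp_sub ((t - θ) * _)]

theorem absolutelyContinuous_natLaw (hθ : θ ∈ E.Θ) (t : ℝ) : E.natLaw t ≪ E.natLaw θ := by
  rw [← tilted_natLaw hθ t]
  exact tilted_absolutelyContinuous _ _

theorem llr_natLaw (hθ : θ ∈ E.Θ) (ht : t ∈ E.Θ) :
    llr (E.natLaw t) (E.natLaw θ) =ᵐ[E.natLaw θ] E.logDensity θ t := by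
  have := isProbabilityMeasure_natLaw hθ
  have llr_tilted := log_rnDeriv_tilted_left_self (integrable_exp_natLaw hθ ht)
  rwa [tilted_natLaw hθ t, integral_exp_natLaw hθ ht, Real.log_exp] at llr_tilted

theorem integrable_logDensity (hs : s ∈ E.Θ) (θ t : ℝ) :
    Integrable (E.logDensity θ t) (E.natLaw s) := by
  have := isProbabilityMeasure_natLaw hs
  exact ((integrable_id_natLaw hs).const_mul _).sub (integrable_const _)

theorem integral_logDensity (hs : s ∈ E.Θ) (θ t : ℝ) :
    ∫ x, E.logDensity θ t x ∂(E.natLaw s) = E.logDensity θ t (E.mean s) := by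
  have := isProbabilityMeasure_natLaw hs
  simp only [logDensity, mean]
  rw [integral_sub ((integrable_id_natLaw hs).const_mul _) (integrable_const _),
    integral_const_mul, integral_const, probReal_univ, one_smul]

theorem toReal_klDiv_natLaw (hθ : θ ∈ E.Θ) (ht : t ∈ E.Θ) :
    (InformationTheory.klDiv (E.natLaw t) (E.natLaw θ)).toReal =
      E.logDensity θ t (E.mean t) := by
  have := isProbabilityMeasure_natLaw hθ
  have := isProbabilityMeasure_natLaw ht
  have hac := absolutelyContinuous_natLaw hθ t
  rw [InformationTheory.toReal_klDiv_of_measure_eq hac (by simp only [measure_univ]),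
    integral_congr_ae (hac.ae_le (llr_natLaw hθ ht)), integral_logDensity ht]

theorem klDiv_natLaw_ne_top (hθ : θ ∈ E.Θ) (ht : t ∈ E.Θ) :
    InformationTheory.klDiv (E.natLaw t) (E.natLaw θ) ≠ ∞ := by
  have hac := absolutelyContinuous_natLaw hθ t
  exact InformationTheory.klDiv_ne_top hac
    ((integrable_logDensity ht _ _).congr (hac.ae_eq (llr_natLaw hθ ht)).symm)

-- If two members coincide, their log-density vanishes almost everywhere; being affine with a
-- nonzero slope, it has a single zero, and the reference measure would be concentrated there.
theorem injOn_natLaw : InjOn E.natLaw E.Θ := by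
  intro t ht θ hθ heq
  by_contra hne
  have := isProbabilityMeasure_natLaw hθ
  have logDensity_ae_zero : 0 =ᵐ[E.natLaw θ] E.logDensity θ t :=
    (llr_self (E.natLaw θ)).symm.trans (by simpa only [heq] using llr_natLaw hθ ht)
  have ae_eq_const :
      ∀ᵐ x ∂(E.natLaw θ), x = (E.logPartition t - E.logPartition θ) / (t - θ) := by
    filter_upwards [logDensity_ae_zero] with x hx
    rw [eq_div_iff (sub_ne_zero.2 hne), mul_comm]
    exact sub_eq_zero.1 hx.symm
  exact E.nondegenerate _
    ((absolutelyContinuous_tilted (E.integrable_exp θ hθ)).ae_le ae_eq_const)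

theorem logDensity_mean_pos (hθ : θ ∈ E.Θ) (ht : t ∈ E.Θ) (hne : t ≠ θ) :
    0 < E.logDensity θ t (E.mean t) := by
  have := isProbabilityMeasure_natLaw hθ
  have := isProbabilityMeasure_natLaw ht
  rw [← toReal_klDiv_natLaw hθ ht]
  exact ENNReal.toReal_pos
    (fun h => hne (injOn_natLaw ht hθ (InformationTheory.klDiv_eq_zero_iff.1 h)))
    (klDiv_natLaw_ne_top hθ ht)

-- The two divergences between `t` and `θ` add up to `(θ - t) * (mean θ - mean t)`.
theorem strictMonoOn_mean : StrictMonoOn E.mean E.Θ := by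
  intro t ht θ hθ hlt
  have forward := logDensity_mean_pos hθ ht hlt.ne
  have backward := logDensity_mean_pos ht hθ hlt.ne'
  simp only [logDensity] at forward backward
  have sum_pos : 0 < (θ - t) * (E.mean θ - E.mean t) := by linarith
  exact sub_pos.1 ((mul_pos_iff_of_pos_left (sub_pos.2 hlt)).1 sum_pos)

theorem continuousOn_mean : ContinuousOn E.mean E.Θ := by
  have continuousOn_deriv : ContinuousOn (deriv (cgf id E.ref)) E.Θ := fun θ hθ =>
    (analyticAt_cgf (mem_interior_integrableExpSet hθ)).deriv.continuousAt.continuousWithinAt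
  exact continuousOn_deriv.congr fun θ hθ =>
    integral_tilted_mul_self (mem_interior_integrableExpSet hθ)

theorem continuousOn_logPartition : ContinuousOn E.logPartition E.Θ := fun _ hθ =>
  (analyticAt_cgf (mem_interior_integrableExpSet hθ)).continuousAt.continuousWithinAt

end NaturalParameter

section Mean

theorem ordConnected_means : E.means.OrdConnected :=
  (E.ordConnected_Θ.isPreconnected.image _ continuousOn_mean).ordConnected

theorem isOpen_means : IsOpen E.means := by
  rw [isOpen_iff_mem_nhds]
  rintro _ ⟨θ, hθ, rfl⟩
  obtain ⟨l, u, -, Icc_nhds, Icc_subset⟩ := exists_Icc_mem_subset_of_mem_nhds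
    (E.isOpen_Θ.mem_nhds hθ)
  obtain ⟨hl, hu⟩ := Icc_mem_nhds_iff.1 Icc_nhds
  have hl_mem : l ∈ E.Θ := Icc_subset (left_mem_Icc.2 (hl.trans hu).le)
  have hu_mem : u ∈ E.Θ := Icc_subset (right_mem_Icc.2 (hl.trans hu).le)
  exact Filter.mem_of_superset
    (Icc_mem_nhds (strictMonoOn_mean hl_mem hθ hl) (strictMonoOn_mean hθ hu_mem hu))
    (ordConnected_means.out (mem_image_of_mem _ hl_mem) (mem_image_of_mem _ hu_mem))

theorem natParam_mem (ha : a ∈ E.means) : E.natParam a ∈ E.Θ :=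
  Function.invFunOn_mem ha

theorem mean_natParam (ha : a ∈ E.means) : E.mean (E.natParam a) = a :=
  Function.invFunOn_eq ha

theorem continuousOn_natParam : ContinuousOn E.natParam E.means :=
  continuousOn_invFunOn_image E.ordConnected_Θ strictMonoOn_mean continuousOn_mean

theorem strictMonoOn_natParam : StrictMonoOn E.natParam E.means := by
  intro a ha b hb hab
  rwa [← strictMonoOn_mean.lt_iff_lt (natParam_mem ha) (natParam_mem hb), mean_natParam ha,
    mean_natParam hb]

theorem isProbabilityMeasure_law (ha : a ∈ E.means) : IsProbabilityMeasure (E.law a) :=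
  isProbabilityMeasure_natLaw (natParam_mem ha)

theorem measurable_logRatio (a b : ℝ) : Measurable (E.logRatio a b) := by
  unfold logRatio logDensity
  fun_prop

theorem law_eq_withDensity (ha : a ∈ E.means) (hb : b ∈ E.means) :
    E.law b = (E.law a).withDensity (fun x => ENNReal.ofReal (Real.exp (E.logRatio a b x))) :=
  natLaw_eq_withDensity (natParam_mem ha) (natParam_mem hb)

theorem d_eq_logRatio (ha : a ∈ E.means) (hb : b ∈ E.means) : E.d a b = E.logRatio b a a := by
  have klDiv_eq := toReal_klDiv_natLaw (natParam_mem hb) (natParam_mem ha)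
  rwa [mean_natParam ha] at klDiv_eq

theorem integrable_logRatio (hc : c ∈ E.means) (a b : ℝ) :
    Integrable (E.logRatio a b) (E.law c) :=
  integrable_logDensity (natParam_mem hc) _ _

theorem integral_logRatio (ha : a ∈ E.means) (hb : b ∈ E.means) :
    ∫ x, E.logRatio a b x ∂(E.law a) = -E.d a b := by
  have integral_eq := integral_logDensity (natParam_mem ha) (E.natParam a) (E.natParam b)
  rw [mean_natParam ha] at integral_eq
  rw [d_eq_logRatio ha hb]
  refine integral_eq.trans ?_
  simp only [logRatio, logDensity]
  ring

end Mean

section Divergence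

theorem d_nonneg (a b : ℝ) : 0 ≤ E.d a b := ENNReal.toReal_nonneg

theorem d_self (ha : a ∈ E.means) : E.d a a = 0 := by
  simp only [d_eq_logRatio ha ha, logRatio, logDensity, sub_self, zero_mul]

theorem d_pos (ha : a ∈ E.means) (hb : b ∈ E.means) (h : a ≠ b) : 0 < E.d a b := by
  have log_pos := logDensity_mean_pos (natParam_mem hb) (natParam_mem ha)
    (strictMonoOn_natParam.injOn.ne ha hb h)
  rwa [mean_natParam ha, ← logRatio, ← d_eq_logRatio ha hb] at log_pos

theorem continuousOn_d (ha : a ∈ E.means) : ContinuousOn (E.d a) E.means := by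
  refine ContinuousOn.congr ?_ fun b hb => d_eq_logRatio ha hb
  exact ((continuousOn_const.sub continuousOn_natParam).mul continuousOn_const).sub
    (continuousOn_const.sub
      (continuousOn_logPartition.comp continuousOn_natParam fun b hb => natParam_mem hb))

theorem d_eq_d_add_d (ha : a ∈ E.means) (hb : b ∈ E.means) (hc : c ∈ E.means) :
    E.d a c = E.d a b + E.d b c + (E.natParam b - E.natParam c) * (a - b) := by
  simp only [d_eq_logRatio, ha, hb, hc, logRatio, logDensity]
  ring

theorem strictMonoOn_d (ha : a ∈ E.means) : StrictMonoOn (E.d a) (E.means ∩ Ici a) := by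
  rintro b ⟨hb, hab⟩ c ⟨hc, -⟩ hbc
  have d_bc_pos := d_pos hb hc hbc.ne
  have correction_nonneg : 0 ≤ (E.natParam b - E.natParam c) * (a - b) :=
    mul_nonneg_of_nonpos_of_nonpos (sub_nonpos.2 (strictMonoOn_natParam hb hc hbc).le)
      (sub_nonpos.2 hab)
  rw [d_eq_d_add_d ha hb hc]
  linarith

theorem strictAntiOn_d (ha : a ∈ E.means) : StrictAntiOn (E.d a) (E.means ∩ Iic a) := by
  rintro c ⟨hc, -⟩ b ⟨hb, hba⟩ hcb
  have d_bc_pos := d_pos hb hc hcb.ne'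
  have correction_nonneg : 0 ≤ (E.natParam b - E.natParam c) * (a - b) :=
    mul_nonneg (sub_nonneg.2 (strictMonoOn_natParam hc hb hcb).le) (sub_nonneg.2 hba)
  rw [d_eq_d_add_d ha hb hc]
  linarith

-- The corrections in the two three-point identities cancel because `c` is the weighted mean.
theorem mul_d_add_mul_d {m p q : ℝ} (ha : a ∈ E.means) (hb : b ∈ E.means)
    (hc : c ∈ E.means) (hm : m ∈ E.means) (h : p * a + q * b = (p + q) * c) :
    p * E.d a m + q * E.d b m = p * E.d a c + q * E.d b c + (p + q) * E.d c m := by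
  rw [d_eq_d_add_d ha hc hm, d_eq_d_add_d hb hc hm]
  linear_combination (E.natParam c - E.natParam m) * h

end Divergence

end ExpFamily

/-! ### The equilibrium equation -/

section TwoSlices

open Filter Topology

variable {K : ℕ} {E : ExpFamily} {μ : Fin K → ℝ} {i j k : Fin K} {a x : ℝ}

theorem one_mul_add_mul_eq_mul_mix (hx : 0 ≤ x) : 1 * μ k + x * μ j = (1 + x) * mix μ j k x := by
  have : 1 + x ≠ 0 := by positivity
  rw [mix, one_mul, mul_div_cancel₀ _ this]

theorem mix_eq_add_div (hx : 0 ≤ x) : mix μ j k x = μ j + (μ k - μ j) / (1 + x) := by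
  have : 1 + x ≠ 0 := by positivity
  rw [mix]
  field_simp
  ring

theorem mix_zero : mix μ j k 0 = μ k := by
  rw [mix, zero_mul, add_zero, add_zero, div_one]

theorem mix_ne (hne : μ j ≠ μ k) (hx : 0 ≤ x) : mix μ j k x ≠ μ j := by
  rw [mix_eq_add_div hx, Ne, add_eq_left]
  exact div_ne_zero (sub_ne_zero.2 hne.symm) (by positivity)

theorem lt_mix (hlt : μ j < μ k) (hx : 0 ≤ x) : μ j < mix μ j k x := by
  rw [mix_eq_add_div hx]
  exact lt_add_of_pos_right _ (div_pos (sub_pos.2 hlt) (by positivity))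

theorem strictAntiOn_mix (hlt : μ j < μ k) : StrictAntiOn (mix μ j k) (Ici 0) := by
  intro x (hx : 0 ≤ x) y (hy : 0 ≤ y) hxy
  rw [mix_eq_add_div hx, mix_eq_add_div hy]
  gcongr

theorem mix_le (hlt : μ j < μ k) (hx : 0 ≤ x) : mix μ j k x ≤ μ k :=
  ((strictAntiOn_mix hlt).antitoneOn self_mem_Ici hx hx).trans_eq mix_zero

theorem mix_mem_means (hj : μ j ∈ E.means) (hk : μ k ∈ E.means) (hx : 0 ≤ x) :
    mix μ j k x ∈ E.means := by
  have hx' : 1 + x ≠ 0 := by positivity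
  convert ExpFamily.ordConnected_means.convex hk hj (a := 1 / (1 + x)) (b := x / (1 + x))
    (by positivity) (by positivity) (by field_simp) using 1
  simp only [mix, smul_eq_mul]
  ring

theorem continuousOn_mix : ContinuousOn (mix μ j k) (Ici 0) := by
  unfold mix
  refine ContinuousOn.div (by fun_prop) (by fun_prop) fun x (hx : 0 ≤ x) => ?_
  positivity

theorem tendsto_mix : Tendsto (mix μ j k) atTop (𝓝 (μ j)) := by
  have tendsto_add_div : Tendsto (fun x => μ j + (μ k - μ j) / (1 + x)) atTop (𝓝 (μ j + 0)) :=
    tendsto_const_nhds.add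
      (tendsto_const_nhds.div_atTop (tendsto_atTop_add_const_left _ _ tendsto_id))
  rw [add_zero] at tendsto_add_div
  refine tendsto_add_div.congr' ?_
  filter_upwards [eventually_ge_atTop 0] with x hx using (mix_eq_add_div hx).symm

theorem eq_mul_of_add_eq_mul_mix {p q : ℝ} (hne : μ j ≠ μ k) (hx : 0 ≤ x)
    (h : p * μ k + q * μ j = (p + q) * mix μ j k x) : q = x * p := by
  have hx' : 1 + x ≠ 0 := by positivity
  rw [mix_eq_add_div hx] at h
  field_simp at h
  exact mul_right_cancel₀ (sub_ne_zero.2 hne) (by linear_combination h)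

theorem continuousOn_d_mix (hj : μ j ∈ E.means) (hk : μ k ∈ E.means) (ha : a ∈ E.means) :
    ContinuousOn (fun x => E.d a (mix μ j k x)) (Ici 0) :=
  (ExpFamily.continuousOn_d ha).comp continuousOn_mix fun _ hx => mix_mem_means hj hk hx

theorem tendsto_d_mix (hj : μ j ∈ E.means) (ha : a ∈ E.means) :
    Tendsto (fun x => E.d a (mix μ j k x)) atTop (𝓝 (E.d a (μ j))) :=
  ((ExpFamily.continuousOn_d ha).continuousAt
    (ExpFamily.isOpen_means.mem_nhds hj)).tendsto.comp tendsto_mix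

theorem d_mix_pos (hj : μ j ∈ E.means) (hk : μ k ∈ E.means) (hne : μ j ≠ μ k) (hx : 0 ≤ x) :
    0 < E.d (μ j) (mix μ j k x) :=
  ExpFamily.d_pos hj (mix_mem_means hj hk hx) (mix_ne hne hx).symm

theorem strictMonoOn_d_mix (hj : μ j ∈ E.means) (hk : μ k ∈ E.means) (hlt : μ j < μ k) :
    StrictMonoOn (fun x => E.d (μ k) (mix μ j k x)) (Ici 0) := fun _ hx _ hy hxy =>
  ExpFamily.strictAntiOn_d hk ⟨mix_mem_means hj hk hy, mix_le hlt hy⟩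
    ⟨mix_mem_means hj hk hx, mix_le hlt hx⟩ (strictAntiOn_mix hlt hx hy hxy)

theorem strictAntiOn_d_mix (hj : μ j ∈ E.means) (hk : μ k ∈ E.means) (hlt : μ j < μ k) :
    StrictAntiOn (fun x => E.d (μ j) (mix μ j k x)) (Ici 0) := fun _ hx _ hy hxy =>
  ExpFamily.strictMonoOn_d hj ⟨mix_mem_means hj hk hy, (lt_mix hlt hy).le⟩
    ⟨mix_mem_means hj hk hx, (lt_mix hlt hx).le⟩ (strictAntiOn_mix hlt hx hy hxy)

theorem d_add_mul_d (hj : μ j ∈ E.means) (hk : μ k ∈ E.means) (hx : 0 ≤ x) (ha : a ∈ E.means) :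
    E.d (μ k) a + x * E.d (μ j) a = g E μ j k x + (1 + x) * E.d (mix μ j k x) a := by
  have compensation := ExpFamily.mul_d_add_mul_d hk hj (mix_mem_means hj hk hx) ha
    (one_mul_add_mul_eq_mul_mix hx)
  rw [g]
  linarith

theorem g_le (hj : μ j ∈ E.means) (hk : μ k ∈ E.means) (hx : 0 ≤ x) (ha : a ∈ E.means) :
    g E μ j k x ≤ E.d (μ k) a + x * E.d (μ j) a := by
  rw [d_add_mul_d hj hk hx ha]
  exact le_add_of_nonneg_right (mul_nonneg (by positivity) (ExpFamily.d_nonneg _ _))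

theorem g_lt_d (hj : μ j ∈ E.means) (hk : μ k ∈ E.means) (hne : μ j ≠ μ k) (hx : 0 ≤ x) :
    g E μ j k x < E.d (μ k) (μ j) := by
  have weighted_d := d_add_mul_d hj hk hx hj
  rw [ExpFamily.d_self hj, mul_zero, add_zero] at weighted_d
  rw [weighted_d]
  exact lt_add_of_pos_right _ (mul_pos (by positivity)
    (ExpFamily.d_pos (mix_mem_means hj hk hx) hj (mix_ne hne hx)))

theorem g_zero (hk : μ k ∈ E.means) : g E μ j k 0 = 0 := by
  rw [g, mix_zero, ExpFamily.d_self hk, zero_mul, add_zero]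

theorem strictMonoOn_g (hj : μ j ∈ E.means) (hk : μ k ∈ E.means) (hne : μ j ≠ μ k) :
    StrictMonoOn (g E μ j k) (Ici 0) := by
  intro x hx y hy hxy
  have d_mix_y_pos := d_mix_pos hj hk hne hy
  calc g E μ j k x ≤ E.d (μ k) (mix μ j k y) + x * E.d (μ j) (mix μ j k y) :=
        g_le hj hk hx (mix_mem_means hj hk hy)
    _ < E.d (μ k) (mix μ j k y) + y * E.d (μ j) (mix μ j k y) := by gcongr

theorem continuousOn_g (hj : μ j ∈ E.means) (hk : μ k ∈ E.means) :
    ContinuousOn (g E μ j k) (Ici 0) :=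
  (continuousOn_d_mix hj hk hk).add (continuousOn_id.mul (continuousOn_d_mix hj hk hj))

theorem gRange_eq_Ico (hj : μ j ∈ E.means) (hk : μ k ∈ E.means) (hne : μ j ≠ μ k) :
    gRange E μ j k = Ico 0 (E.d (μ k) (μ j)) := by
  refine Subset.antisymm ?_ fun y ⟨hy0, hyd⟩ => ?_
  · rintro _ ⟨x, hx, rfl⟩
    refine ⟨?_, g_lt_d hj hk hne hx⟩
    rw [← g_zero (j := j) hk]
    exact (strictMonoOn_g hj hk hne).monotoneOn self_mem_Ici hx hx
  · obtain ⟨z, hz0, y_lt_d⟩ := ((eventually_ge_atTop 0).and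
      ((tendsto_d_mix (k := k) hj hk).eventually_const_lt hyd)).exists
    have y_le_g : y ≤ g E μ j k z :=
      y_lt_d.le.trans (le_add_of_nonneg_right (mul_nonneg hz0 (ExpFamily.d_nonneg _ _)))
    obtain ⟨x, hx, rfl⟩ := intermediate_value_Icc hz0
      ((continuousOn_g hj hk).mono Icc_subset_Ici_self) ⟨(g_zero hk).trans_le hy0, y_le_g⟩
    exact ⟨x, hx.1, rfl⟩

theorem nonneg_of_mem_gRange {y : ℝ} (hy : y ∈ gRange E μ j k) : 0 ≤ y := by
  obtain ⟨x, hx, rfl⟩ := hy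
  exact add_nonneg (ExpFamily.d_nonneg _ _) (mul_nonneg hx (ExpFamily.d_nonneg _ _))

theorem ordConnected_gRange (hj : μ j ∈ E.means) (hk : μ k ∈ E.means) :
    (gRange E μ j k).OrdConnected :=
  (ordConnected_Ici.isPreconnected.image _ (continuousOn_g hj hk)).ordConnected

theorem zero_mem_gRange (hk : μ k ∈ E.means) : 0 ∈ gRange E μ j k :=
  ⟨0, self_mem_Ici, g_zero hk⟩

theorem gRange_subset_gRange (hi : μ i ∈ E.means) (hj : μ j ∈ E.means) (hk : μ k ∈ E.means)
    (hji : μ j ≤ μ i) (hik : μ i < μ k) : gRange E μ i k ⊆ gRange E μ j k := by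
  rw [gRange_eq_Ico hi hk hik.ne, gRange_eq_Ico hj hk (hji.trans_lt hik).ne]
  exact Ico_subset_Ico_right ((ExpFamily.strictAntiOn_d hk).antitoneOn
    ⟨hj, (hji.trans_lt hik).le⟩ ⟨hi, hik.le⟩ hji)

theorem xInv_self (y : ℝ) : xInv E μ k k y = 1 := if_pos rfl

theorem xInv_of_ne (hjk : j ≠ k) : xInv E μ j k = Function.invFunOn (g E μ j k) (Ici 0) :=
  funext fun _ => if_neg hjk

theorem xInv_nonneg {y : ℝ} (hjk : j ≠ k) (hy : y ∈ gRange E μ j k) : 0 ≤ xInv E μ j k y := by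
  rw [xInv_of_ne hjk]
  exact Function.invFunOn_mem hy

theorem g_xInv {y : ℝ} (hjk : j ≠ k) (hy : y ∈ gRange E μ j k) :
    g E μ j k (xInv E μ j k y) = y := by
  rw [xInv_of_ne hjk]
  exact Function.invFunOn_eq hy

theorem xInv_g (hj : μ j ∈ E.means) (hk : μ k ∈ E.means) (hne : μ j ≠ μ k) (hx : 0 ≤ x) :
    xInv E μ j k (g E μ j k x) = x := by
  rw [xInv_of_ne (ne_of_apply_ne μ hne)]
  exact (strictMonoOn_g hj hk hne).injOn.leftInvOn_invFunOn hx

theorem continuousOn_xInv (hj : μ j ∈ E.means) (hk : μ k ∈ E.means) (hne : μ j ≠ μ k) :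
    ContinuousOn (xInv E μ j k) (gRange E μ j k) := by
  rw [xInv_of_ne (ne_of_apply_ne μ hne)]
  exact continuousOn_invFunOn_image ordConnected_Ici (strictMonoOn_g hj hk hne)
    (continuousOn_g hj hk)

theorem strictMonoOn_xInv (hj : μ j ∈ E.means) (hk : μ k ∈ E.means) (hne : μ j ≠ μ k) :
    StrictMonoOn (xInv E μ j k) (gRange E μ j k) := by
  rintro _ ⟨x, hx, rfl⟩ _ ⟨y, hy, rfl⟩ hxy
  rw [xInv_g hj hk hne hx, xInv_g hj hk hne hy]
  exact ((strictMonoOn_g hj hk hne).lt_iff_lt hx hy).1 hxy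

/-- The summand of slice `j` in the equilibrium function `F_k`, as a function of the weight
`x = x_{j,k}(y)`. -/
def mixRatio (E : ExpFamily) (μ : Fin K → ℝ) (j k : Fin K) (x : ℝ) : ℝ :=
  E.d (μ k) (mix μ j k x) / E.d (μ j) (mix μ j k x)

theorem mixRatio_zero (hk : μ k ∈ E.means) : mixRatio E μ j k 0 = 0 := by
  rw [mixRatio, mix_zero, ExpFamily.d_self hk, zero_div]

theorem mixRatio_nonneg (x : ℝ) : 0 ≤ mixRatio E μ j k x :=
  div_nonneg (ExpFamily.d_nonneg _ _) (ExpFamily.d_nonneg _ _)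

theorem strictMonoOn_mixRatio (hj : μ j ∈ E.means) (hk : μ k ∈ E.means) (hlt : μ j < μ k) :
    StrictMonoOn (mixRatio E μ j k) (Ici 0) := fun _ hx _ hy hxy =>
  div_lt_div₀ (strictMonoOn_d_mix hj hk hlt hx hy hxy)
    (strictAntiOn_d_mix hj hk hlt hx hy hxy).le (ExpFamily.d_nonneg _ _)
    (d_mix_pos hj hk hlt.ne hy)

theorem continuousOn_mixRatio (hj : μ j ∈ E.means) (hk : μ k ∈ E.means) (hne : μ j ≠ μ k) :
    ContinuousOn (mixRatio E μ j k) (Ici 0) :=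
  (continuousOn_d_mix hj hk hk).div (continuousOn_d_mix hj hk hj) fun _ hx =>
    (d_mix_pos hj hk hne hx).ne'

theorem exists_one_le_mixRatio (hj : μ j ∈ E.means) (hk : μ k ∈ E.means) (hne : μ j ≠ μ k) :
    ∃ x, 0 ≤ x ∧ 1 ≤ mixRatio E μ j k x := by
  have denominator_tendsto_zero := tendsto_d_mix (k := k) hj hj
  rw [ExpFamily.d_self hj] at denominator_tendsto_zero
  obtain ⟨x, hx, denominator_lt⟩ := ((eventually_ge_atTop 0).and
    (denominator_tendsto_zero.eventually_lt (tendsto_d_mix (k := k) hj hk)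
      (ExpFamily.d_pos hk hj hne.symm))).exists
  exact ⟨x, hx, (one_le_div (d_mix_pos hj hk hne hx)).2 denominator_lt.le⟩

end TwoSlices

section Equilibrium

variable {K : ℕ} {E : ExpFamily} {γ : ℝ} {μ : Fin K → ℝ} {j k : Fin K}

/-- The common domain of the functions `x_{j,k}` for the slices `j` that are less loaded than `k`,
i.e. the domain of `F_k(·; S)` for the set `S` of these slices. It is the whole line if there is
no such slice. -/
def equilibriumDomain (E : ExpFamily) (μ : Fin K → ℝ) (k : Fin K) : Set ℝ :=
  ⋂ j ∈ lessLoaded μ k, gRange E μ j k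

theorem mem_lessLoaded : j ∈ lessLoaded μ k ↔ μ j < μ k := by
  simp only [lessLoaded, Finset.mem_filter_univ]

theorem mem_equilibriumDomain {y : ℝ} :
    y ∈ equilibriumDomain E μ k ↔ ∀ j ∈ lessLoaded μ k, y ∈ gRange E μ j k :=
  mem_iInter₂

theorem F_lessLoaded_zero (hm : ∀ i, μ i ∈ E.means) : F E μ k (lessLoaded μ k) 0 = 0 := by
  refine Finset.sum_eq_zero fun j hj => ?_
  have xInv_zero : xInv E μ j k 0 = 0 := by
    simpa only [g_zero (hm k)] using
      xInv_g (hm j) (hm k) (mem_lessLoaded.1 hj).ne (le_refl (0 : ℝ))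
  rw [xInv_zero]
  exact mixRatio_zero (hm k)

theorem strictMonoOn_F (hm : ∀ i, μ i ∈ E.means) (hne : (lessLoaded μ k).Nonempty) :
    StrictMonoOn (F E μ k (lessLoaded μ k)) (equilibriumDomain E μ k) := by
  intro y hy z hz hyz
  refine Finset.sum_lt_sum_of_nonempty hne fun j hj => ?_
  have hlt := mem_lessLoaded.1 hj
  have hyj := mem_equilibriumDomain.1 hy j hj
  have hzj := mem_equilibriumDomain.1 hz j hj
  exact strictMonoOn_mixRatio (hm j) (hm k) hlt (xInv_nonneg (ne_of_apply_ne μ hlt.ne) hyj)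
    (xInv_nonneg (ne_of_apply_ne μ hlt.ne) hzj)
    (strictMonoOn_xInv (hm j) (hm k) hlt.ne hyj hzj hyz)

theorem continuousOn_F (hm : ∀ i, μ i ∈ E.means) :
    ContinuousOn (F E μ k (lessLoaded μ k)) (equilibriumDomain E μ k) := by
  refine continuousOn_finsetSum _ fun j hj => ?_
  have hne := (mem_lessLoaded.1 hj).ne
  exact (continuousOn_mixRatio (hm j) (hm k) hne).comp
    ((continuousOn_xInv (hm j) (hm k) hne).mono (biInter_subset_of_mem hj))
    fun y hy => xInv_nonneg (ne_of_apply_ne μ hne) (mem_equilibriumDomain.1 hy j hj)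

theorem ordConnected_equilibriumDomain (hm : ∀ i, μ i ∈ E.means) :
    (equilibriumDomain E μ k).OrdConnected :=
  ordConnected_biInter fun j _ => ordConnected_gRange (hm j) (hm k)

-- The domain is the range of `g_{i,k}` for the most loaded slice `i` of `lessLoaded μ k`, and
-- already the summand of this slice attains the value `1`.
theorem exists_one_le_F (hm : ∀ i, μ i ∈ E.means) (hne : (lessLoaded μ k).Nonempty) :
    ∃ y ∈ equilibriumDomain E μ k, 1 ≤ F E μ k (lessLoaded μ k) y := by
  obtain ⟨i, hi, hmax⟩ := (lessLoaded μ k).exists_max_image μ hne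
  have hik := mem_lessLoaded.1 hi
  obtain ⟨x, hx, one_le_ratio⟩ := exists_one_le_mixRatio (hm i) (hm k) hik.ne
  refine ⟨g E μ i k x, mem_equilibriumDomain.2 fun j hj =>
    gRange_subset_gRange (hm i) (hm j) (hm k) (hmax j hj) hik (mem_image_of_mem _ hx), ?_⟩
  calc 1 ≤ mixRatio E μ i k (xInv E μ i k (g E μ i k x)) := by
        rwa [xInv_g (hm i) (hm k) hik.ne hx]
    _ ≤ F E μ k (lessLoaded μ k) (g E μ i k x) :=
        Finset.single_le_sum (f := fun j => mixRatio E μ j k (xInv E μ j k (g E μ i k x)))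
          (fun j _ => mixRatio_nonneg _) hi

theorem exists_isEquilibrium (hm : ∀ i, μ i ∈ E.means) (hne : (lessLoaded μ k).Nonempty) :
    ∃ y, IsEquilibrium E μ k y := by
  obtain ⟨y, hy, one_le_F⟩ := exists_one_le_F hm hne
  have ordConnected_image : (F E μ k (lessLoaded μ k) '' equilibriumDomain E μ k).OrdConnected :=
    ((ordConnected_equilibriumDomain hm).isPreconnected.image _ (continuousOn_F hm)).ordConnected
  have zero_mem : (0 : ℝ) ∈ equilibriumDomain E μ k :=
    mem_equilibriumDomain.2 fun j _ => zero_mem_gRange (hm k)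
  obtain ⟨z, hz, F_z⟩ := ordConnected_image.out (mem_image_of_mem _ zero_mem)
    (mem_image_of_mem _ hy) ⟨(F_lessLoaded_zero hm).trans_le zero_le_one, one_le_F⟩
  exact ⟨z, mem_equilibriumDomain.1 hz, F_z⟩

theorem existsUnique_isEquilibrium (hm : ∀ i, μ i ∈ E.means)
    (hne : (lessLoaded μ k).Nonempty) : ∃! y, IsEquilibrium E μ k y := by
  obtain ⟨y, hy⟩ := exists_isEquilibrium hm hne
  exact ⟨y, hy, fun z hz => (strictMonoOn_F hm hne).injOn (mem_equilibriumDomain.2 hz.1)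
    (mem_equilibriumDomain.2 hy.1) (hz.2.trans hy.2.symm)⟩

theorem isEquilibrium_yStar (hm : ∀ i, μ i ∈ E.means) (hne : (lessLoaded μ k).Nonempty) :
    IsEquilibrium E μ k (yStar E μ k) :=
  Classical.epsilon_spec (exists_isEquilibrium hm hne)

theorem yStar_pos (hm : ∀ i, μ i ∈ E.means) (hne : (lessLoaded μ k).Nonempty) :
    0 < yStar E μ k := by
  obtain ⟨yStar_mem, F_yStar⟩ := isEquilibrium_yStar hm hne
  obtain ⟨i, hi⟩ := hne
  refine (nonneg_of_mem_gRange (yStar_mem i hi)).lt_of_ne fun yStar_zero => ?_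
  rw [← yStar_zero, F_lessLoaded_zero hm] at F_yStar
  exact zero_ne_one F_yStar

theorem zStar_of_nonempty (hne : (lessLoaded μ k).Nonempty) :
    zStar E γ μ k = min (E.d (μ k) γ) (yStar E μ k) := if_pos hne

theorem zStar_of_not_nonempty (hne : ¬(lessLoaded μ k).Nonempty) :
    zStar E γ μ k = E.d (μ k) γ := if_neg hne

theorem zStar_pos (hγ : γ ∈ E.means) (hm : ∀ i, μ i ∈ E.means) (hk : μ k ≠ γ) :
    0 < zStar E γ μ k := by
  have d_pos := ExpFamily.d_pos (hm k) hγ hk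
  by_cases hne : (lessLoaded μ k).Nonempty
  · exact (zStar_of_nonempty hne).symm ▸ lt_min d_pos (yStar_pos hm hne)
  · exact (zStar_of_not_nonempty hne).symm ▸ d_pos

theorem zStar_le : zStar E γ μ k ≤ E.d (μ k) γ := by
  by_cases hne : (lessLoaded μ k).Nonempty
  · exact (zStar_of_nonempty hne).trans_le (min_le_left _ _)
  · exact (zStar_of_not_nonempty hne).le

theorem zStar_mem_gRange (hγ : γ ∈ E.means) (hm : ∀ i, μ i ∈ E.means) (hk : μ k ≠ γ)
    (hj : j ∈ lessLoaded μ k) : zStar E γ μ k ∈ gRange E μ j k :=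
  (ordConnected_gRange (hm j) (hm k)).out (zero_mem_gRange (hm k))
    ((isEquilibrium_yStar hm ⟨j, hj⟩).1 j hj)
    ⟨(zStar_pos hγ hm hk).le, (zStar_of_nonempty ⟨j, hj⟩).trans_le (min_le_right _ _)⟩

theorem F_zStar (hγ : γ ∈ E.means) (hm : ∀ i, μ i ∈ E.means) (hk : μ k ≠ γ) :
    F E μ k (lessLoaded μ k) (zStar E γ μ k) = 1 ∨
      F E μ k (lessLoaded μ k) (zStar E γ μ k) < 1 ∧ zStar E γ μ k = E.d (μ k) γ := by
  by_cases hne : (lessLoaded μ k).Nonempty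
  · obtain ⟨yStar_mem, F_yStar⟩ := isEquilibrium_yStar hm hne
    have zStar_eq := zStar_of_nonempty (E := E) (γ := γ) hne
    rcases le_or_gt (yStar E μ k) (E.d (μ k) γ) with hyd | hdy
    · exact .inl (by rw [zStar_eq, min_eq_right hyd, F_yStar])
    · rw [min_eq_left hdy.le] at zStar_eq
      refine .inr ⟨?_, zStar_eq⟩
      calc F E μ k (lessLoaded μ k) (zStar E γ μ k) < F E μ k (lessLoaded μ k) (yStar E μ k) :=
            strictMonoOn_F hm hne (mem_equilibriumDomain.2 fun j => zStar_mem_gRange hγ hm hk)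
              (mem_equilibriumDomain.2 yStar_mem) (zStar_eq.trans_lt hdy)
        _ = 1 := F_yStar
  · refine .inr ⟨?_, zStar_of_not_nonempty hne⟩
    rw [Finset.not_nonempty_iff_eq_empty.1 hne, F, Finset.sum_empty]
    exact zero_lt_one

end Equilibrium

/-! ### Alternatives and optimal proportions -/

theorem dense_injective_ne {ι : Type*} [Finite ι] (γ : ℝ) :
    Dense {ν : ι → ℝ | Function.Injective ν ∧ ∀ i, ν i ≠ γ} := by
  cases nonempty_fintype ι
  refine Measure.dense_of_ae (μ := volume) (Filter.Eventually.and ?_ ?_)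
  · have apply_ne_apply : ∀ i j, i ≠ j → ∀ᵐ ν : ι → ℝ, ν i ≠ ν j := by
      intro i j hij
      have ker_ne_top : ((LinearMap.proj i : (ι → ℝ) →ₗ[ℝ] ℝ) - LinearMap.proj j).ker ≠ ⊤ := by
        classical
        refine fun h => one_ne_zero (α := ℝ) ?_
        simpa [hij.symm] using LinearMap.mem_ker.1 (h.ge (x := Pi.single i 1) trivial)
      refine measure_mono_null (fun ν hν => ?_) (Measure.addHaar_submodule volume _ ker_ne_top)
      simpa [sub_eq_zero] using hν
    filter_upwards [ae_all_iff.2 fun i => ae_all_iff.2 fun j => ae_all_iff.2 (apply_ne_apply i j)]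
      with ν hν i j
    exact not_imp_not.1 (hν i j)
  · exact ae_all_iff.2 fun i => Measure.ae_eval_ne (fun _ : ι => (volume : Measure ℝ)) i γ

section Alternatives

open Function

variable {K : ℕ} {E : ExpFamily} {γ m r : ℝ} {μ ν w : Fin K → ℝ} {j k : Fin K}

theorem succ_mem_correct : k.succ ∈ correct γ ν ↔ IsPackingSlice γ ν k := by
  simp [correct, Fin.succ_ne_zero]

theorem mem_alt_succ : ν ∈ alt E γ k.succ ↔ ν ∈ instances E γ ∧ ¬IsPackingSlice γ ν k := by
  rw [← succ_mem_correct]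
  rfl

/-- The information `∑ i, w i * d (μ i, ν i)` against `ν` that is collected under `μ` when slice
`i` is measured `w i` times; `rate` is its infimum over the alternatives. -/
def cost (E : ExpFamily) (μ w ν : Fin K → ℝ) : ℝ := ∑ i, w i * E.d (μ i) (ν i)

theorem cost_self (hm : ∀ i, μ i ∈ E.means) (w : Fin K → ℝ) : cost E μ w μ = 0 :=
  Finset.sum_eq_zero fun i _ => by rw [ExpFamily.d_self (hm i), mul_zero]

theorem cost_update (hj : μ j ∈ E.means) (hν : ν j = μ j) (w : Fin K → ℝ) (m : ℝ) :
    cost E μ w (update ν j m) = cost E μ w ν + w j * E.d (μ j) m := by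
  rw [← sub_eq_iff_eq_add', cost, cost, ← Finset.sum_sub_distrib, Finset.sum_eq_single j]
  · rw [update_self, hν, ExpFamily.d_self hj, mul_zero, sub_zero]
  · intro i _ hij
    rw [update_of_ne hij, sub_self]
  · exact fun h => absurd (Finset.mem_univ j) h

theorem continuousAt_cost (hm : ∀ i, μ i ∈ E.means) (hν : ∀ i, ν i ∈ E.means) :
    ContinuousAt (cost E μ w) ν := by
  refine tendsto_finsetSum _ fun i _ => Filter.Tendsto.const_mul _ ?_
  exact ((ExpFamily.continuousOn_d (hm i)).continuousAt
    (ExpFamily.isOpen_means.mem_nhds (hν i))).tendsto.comp ((continuous_apply i).tendsto ν)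

-- `alt` lacks the degenerate load vectors with a load equal to `γ` or with ties, but these form
-- finitely many hyperplanes.
theorem mem_closure_alt {U : Set (Fin K → ℝ)} (hU : IsOpen U)
    (hUk : ∀ ν ∈ U, ¬IsPackingSlice γ ν k) (hνU : ν ∈ closure U) (hν : ∀ i, ν i ∈ E.means) :
    ν ∈ closure (alt E γ k.succ) := by
  have isOpen_means_pi : IsOpen (univ.pi fun _ : Fin K => E.means) :=
    isOpen_set_pi finite_univ fun _ _ => ExpFamily.isOpen_means
  have mem_closure_inter : ν ∈ closure ((univ.pi fun _ => E.means) ∩ U) :=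
    isOpen_means_pi.inter_closure ⟨fun i _ => hν i, hνU⟩
  refine closure_minimal (((dense_injective_ne γ).open_subset_closure_inter
    (isOpen_means_pi.inter hU)).trans (closure_mono ?_)) isClosed_closure mem_closure_inter
  rintro ν' ⟨⟨hm, hU'⟩, injective, hγ⟩
  exact mem_alt_succ.2 ⟨⟨fun i => hm i trivial, hγ, fun i j hi hj =>
    injective (le_antisymm (hj.2 i hi.1) (hi.2 j hj.1))⟩, hUk ν' hU'⟩

theorem le_cost_of_mem_closure {A : Set (Fin K → ℝ)} (hm : ∀ i, μ i ∈ E.means)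
    (hr : r ∈ lowerBounds (cost E μ w '' A)) (hA : ν ∈ closure A) (hν : ∀ i, ν i ∈ E.means) :
    r ≤ cost E μ w ν :=
  continuousWithinAt_const.closure_le hA (continuousAt_cost hm hν).continuousWithinAt
    fun _ hA => hr (mem_image_of_mem _ hA)

theorem update_mem_means (hν : ∀ i, ν i ∈ E.means) (hmm : m ∈ E.means) (j i : Fin K) :
    update ν j m i ∈ E.means :=
  (forall_update_iff ν fun _ a => a ∈ E.means).2 ⟨hmm, fun i _ => hν i⟩ i

theorem le_mul_d_packing (hγ : γ ∈ E.means) (hm : ∀ i, μ i ∈ E.means)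
    (hr : r ∈ lowerBounds (cost E μ w '' alt E γ k.succ)) : r ≤ w k * E.d (μ k) γ := by
  have mem_closure : update μ k γ ∈ closure {ν : Fin K → ℝ | γ < ν k} :=
    map_mem_closure (continuous_const.update k continuous_id)
      (closure_Ioi γ ▸ self_mem_Ici : γ ∈ closure (Ioi γ)) fun t ht => by
        simpa only [mem_ofPred_eq, update_self] using mem_Ioi.1 ht
  have le_cost := le_cost_of_mem_closure hm hr
    (mem_closure_alt (isOpen_lt continuous_const (continuous_apply k))
      (fun ν (hν : γ < ν k) h => hν.not_gt h.1) mem_closure (update_mem_means hm hγ k))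
    (update_mem_means hm hγ k)
  rwa [cost_update (hm k) rfl, cost_self hm, zero_add] at le_cost

theorem le_mul_d_of_ne (hγ : γ ∈ E.means) (hm : ∀ i, μ i ∈ E.means) (hk : μ k < γ)
    (hjk : j ≠ k) (hr : r ∈ lowerBounds (cost E μ w '' alt E γ k.succ)) :
    r ≤ w j * E.d (μ j) γ := by
  have mem_closure : update μ j γ ∈ closure {ν : Fin K → ℝ | ν k < ν j ∧ ν j < γ} :=
    map_mem_closure (continuous_const.update j continuous_id)
      (closure_Ioo hk.ne ▸ right_mem_Icc.2 hk.le : γ ∈ closure (Ioo (μ k) γ)) fun t ht => by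
        simpa only [mem_ofPred_eq, update_self, update_of_ne hjk.symm] using mem_Ioo.1 ht
  have le_cost := le_cost_of_mem_closure hm hr
    (mem_closure_alt ((isOpen_lt (continuous_apply k) (continuous_apply j)).inter
      (isOpen_lt (continuous_apply j) continuous_const))
      (fun ν hν h => hν.1.not_ge (h.2 j hν.2)) mem_closure (update_mem_means hm hγ j))
    (update_mem_means hm hγ j)
  rwa [cost_update (hm j) rfl, cost_self hm, zero_add] at le_cost

theorem le_mul_d_add_mul_d (hm : ∀ i, μ i ∈ E.means) (hmm : m ∈ E.means) (hmγ : m < γ)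
    (hjk : j ≠ k) (hr : r ∈ lowerBounds (cost E μ w '' alt E γ k.succ)) :
    r ≤ w k * E.d (μ k) m + w j * E.d (μ j) m := by
  have mem_closure :
      update (update μ k m) j m ∈ closure {ν : Fin K → ℝ | ν k < ν j ∧ ν j < γ} :=
    map_mem_closure (continuous_const.update j continuous_id)
      (closure_Ioo hmγ.ne ▸ left_mem_Icc.2 hmγ.le : m ∈ closure (Ioo m γ)) fun t ht => by
        simpa only [mem_ofPred_eq, update_self, update_of_ne hjk.symm] using mem_Ioo.1 ht
  have mem_means := update_mem_means (update_mem_means hm hmm k) hmm j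
  have le_cost := le_cost_of_mem_closure hm hr
    (mem_closure_alt ((isOpen_lt (continuous_apply k) (continuous_apply j)).inter
      (isOpen_lt (continuous_apply j) continuous_const))
      (fun ν hν h => hν.1.not_ge (h.2 j hν.2)) mem_closure mem_means) mem_means
  rwa [cost_update (hm j) (update_of_ne hjk _ _), cost_update (hm k) rfl, cost_self hm,
    zero_add] at le_cost

end Alternatives

section Duality

variable {K : ℕ} {E : ExpFamily} {γ r : ℝ} {μ ν w : Fin K → ℝ} {j k : Fin K}

theorem g_le_of_lt {x a b : ℝ} (hj : μ j ∈ E.means) (hk : μ k ∈ E.means) (hlt : μ j < μ k)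
    (hx : 0 ≤ x) (ha : a ∈ E.means) (hb : b ∈ E.means) (hab : a < b) :
    g E μ j k x ≤ E.d (μ k) a + x * E.d (μ j) b := by
  suffices closer : ∃ m ∈ E.means, E.d (μ k) m ≤ E.d (μ k) a ∧ E.d (μ j) m ≤ E.d (μ j) b by
    obtain ⟨m, hm, d_le_a, d_le_b⟩ := closer
    exact (g_le hj hk hx hm).trans (by gcongr)
  have monotoneOn := (ExpFamily.strictMonoOn_d hj).monotoneOn
  rcases le_total (μ k) a with hka | hak
  · exact ⟨μ k, hk, (ExpFamily.d_self hk).trans_le (ExpFamily.d_nonneg _ _),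
      monotoneOn ⟨hk, hlt.le⟩ ⟨hb, (hlt.trans_le hka).le.trans hab.le⟩ (hka.trans hab.le)⟩
  rcases le_total (μ j) a with hja | haj
  · exact ⟨a, ha, le_rfl, monotoneOn ⟨ha, hja⟩ ⟨hb, hja.trans hab.le⟩ hab.le⟩
  · exact ⟨μ j, hj, (ExpFamily.strictAntiOn_d hk).antitoneOn ⟨ha, hak⟩ ⟨hj, hlt.le⟩ haj,
      (ExpFamily.d_self hj).trans_le (ExpFamily.d_nonneg _ _)⟩

-- By the compensation identity the barycentre is the only minimiser of the weighted divergence.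
theorem eq_mul_of_weighted_d_le {p q c x : ℝ} (hj : μ j ∈ E.means) (hk : μ k ∈ E.means)
    (hne : μ j ≠ μ k) (hx : 0 ≤ x) (hc : c ∈ E.means) (hpq : 0 < p + q)
    (barycentre : p * μ k + q * μ j = (p + q) * c)
    (hle : p * E.d (μ k) (mix μ j k x) + q * E.d (μ j) (mix μ j k x) ≤
      p * E.d (μ k) c + q * E.d (μ j) c) : q = x * p := by
  have hmix := mix_mem_means hj hk hx
  have compensation := ExpFamily.mul_d_add_mul_d hk hj hc hmix barycentre
  have c_eq_mix : c = mix μ j k x := by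
    by_contra hne
    have := mul_pos hpq (ExpFamily.d_pos hc hmix hne)
    linarith
  exact eq_mul_of_add_eq_mul_mix hne hx (c_eq_mix ▸ barycentre)

theorem mem_lessLoaded_of_lt (hμ : μ ∈ instances E γ) (hk : IsPackingSlice γ μ k) (hj : μ j < γ)
    (hjk : j ≠ k) : j ∈ lessLoaded μ k :=
  mem_lessLoaded.2 <| (hk.2 j hj).lt_of_ne fun h =>
    hjk (hμ.2.2 j k ⟨hj, fun i hi => (hk.2 i hi).trans_eq h.symm⟩ hk)

theorem slice_trichotomy (hμ : μ ∈ instances E γ) (hk : IsPackingSlice γ μ k) (j : Fin K) :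
    γ < μ j ∨ j = k ∨ j ∈ lessLoaded μ k := by
  rcases (hμ.2.1 j).lt_or_gt with hj | hj
  · exact .inr (or_iff_not_imp_left.2 (mem_lessLoaded_of_lt hμ hk hj))
  · exact .inl hj

theorem sum_eq_sum_add_sum_lessLoaded (hμ : μ ∈ instances E γ) (hk : IsPackingSlice γ μ k)
    (f : Fin K → ℝ) :
    ∑ j, f j = ∑ j with γ < μ j, f j + (f k + ∑ j ∈ lessLoaded μ k, f j) := by
  have filter_not_lt :
      ({j | ¬γ < μ j} : Finset (Fin K)) = insert k (lessLoaded μ k) := by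
    ext j
    simp only [Finset.mem_filter_univ, Finset.mem_insert]
    refine ⟨fun h => (slice_trichotomy hμ hk j).resolve_left h, ?_⟩
    rintro (rfl | hj)
    exacts [hk.1.not_gt, ((mem_lessLoaded.1 hj).trans hk.1).not_gt]
  rw [← Finset.sum_filter_add_sum_filter_not Finset.univ fun j => γ < μ j, filter_not_lt,
    Finset.sum_insert fun h => (mem_lessLoaded.1 h).false]

/-- The optimal number `x_{j,k}(z*)` of measurements of slice `j` per measurement of slice `k`. -/
def xStar (E : ExpFamily) (γ : ℝ) (μ : Fin K → ℝ) (k j : Fin K) : ℝ :=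
  xInv E μ j k (zStar E γ μ k)

/-- The common load of slices `j` and `k` in the least costly alternative that confuses them. -/
def mStar (E : ExpFamily) (γ : ℝ) (μ : Fin K → ℝ) (k j : Fin K) : ℝ :=
  mix μ j k (xStar E γ μ k j)

theorem xStar_nonneg (hγ : γ ∈ E.means) (hm : ∀ i, μ i ∈ E.means) (hk : μ k ≠ γ)
    (hj : j ∈ lessLoaded μ k) : 0 ≤ xStar E γ μ k j :=
  xInv_nonneg (ne_of_apply_ne μ (mem_lessLoaded.1 hj).ne) (zStar_mem_gRange hγ hm hk hj)

theorem g_xStar (hγ : γ ∈ E.means) (hm : ∀ i, μ i ∈ E.means) (hk : μ k ≠ γ)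
    (hj : j ∈ lessLoaded μ k) : g E μ j k (xStar E γ μ k j) = zStar E γ μ k :=
  g_xInv (ne_of_apply_ne μ (mem_lessLoaded.1 hj).ne) (zStar_mem_gRange hγ hm hk hj)

theorem d_mStar_pos (hγ : γ ∈ E.means) (hm : ∀ i, μ i ∈ E.means) (hk : μ k ≠ γ)
    (hj : j ∈ lessLoaded μ k) : 0 < E.d (μ j) (mStar E γ μ k j) :=
  d_mix_pos (hm j) (hm k) (mem_lessLoaded.1 hj).ne (xStar_nonneg hγ hm hk hj)

theorem le_mul_d_mStar_add (hγ : γ ∈ E.means) (hm : ∀ i, μ i ∈ E.means) (hk : μ k < γ)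
    (hr : r ∈ lowerBounds (cost E μ w '' alt E γ k.succ)) (hj : j ∈ lessLoaded μ k) :
    r ≤ w k * E.d (μ k) (mStar E γ μ k j) + w j * E.d (μ j) (mStar E γ μ k j) :=
  have hlt := mem_lessLoaded.1 hj
  have hx := xStar_nonneg hγ hm hk.ne hj
  le_mul_d_add_mul_d hm (mix_mem_means (hm j) (hm k) hx) ((mix_le hlt hx).trans_lt hk)
    (ne_of_apply_ne μ hlt.ne) hr

/-- The numbers of measurements in the proportions `wStar` that collect one unit of information
against the closest alternative; their sum is `T2`. -/
def optCount (E : ExpFamily) (γ : ℝ) (μ : Fin K → ℝ) (k j : Fin K) : ℝ :=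
  (if μ j < γ then xInv E μ j k (zStar E γ μ k) / zStar E γ μ k else 0) +
    (if μ j > γ then 1 / E.d (μ j) γ else 0)

theorem wStar_eq : wStar E γ μ k = (T2 E γ μ k)⁻¹ • optCount E γ μ k := by
  ext j
  rw [wStar, one_div, Pi.smul_apply, smul_eq_mul, optCount]

theorem optCount_of_gt (hj : γ < μ j) : optCount E γ μ k j = 1 / E.d (μ j) γ := by
  rw [optCount, if_neg hj.not_gt, if_pos hj, zero_add]

theorem optCount_of_lt (hj : μ j < γ) :
    optCount E γ μ k j = xStar E γ μ k j / zStar E γ μ k := by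
  rw [optCount, if_pos hj, if_neg hj.not_gt, add_zero, xStar]

theorem optCount_self (hk : μ k < γ) : optCount E γ μ k k = 1 / zStar E γ μ k := by
  rw [optCount_of_lt hk, xStar, xInv_self]

theorem optCount_lessLoaded (hk : μ k < γ) (hj : j ∈ lessLoaded μ k) :
    optCount E γ μ k j = xStar E γ μ k j / zStar E γ μ k :=
  optCount_of_lt ((mem_lessLoaded.1 hj).trans hk)

theorem optCount_nonneg (hγ : γ ∈ E.means) (hμ : μ ∈ instances E γ)
    (hk : IsPackingSlice γ μ k) (j : Fin K) : 0 ≤ optCount E γ μ k j := by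
  have hz := zStar_pos hγ hμ.1 hk.1.ne
  rcases slice_trichotomy hμ hk j with hj | rfl | hj
  · exact (optCount_of_gt hj).symm ▸ one_div_nonneg.2 (ExpFamily.d_nonneg _ _)
  · exact (optCount_self hk.1).symm ▸ one_div_nonneg.2 hz.le
  · exact (optCount_lessLoaded hk.1 hj).symm ▸ div_nonneg (xStar_nonneg hγ hμ.1 hk.1.ne hj) hz.le

theorem sum_optCount (hμ : μ ∈ instances E γ) (hk : IsPackingSlice γ μ k) :
    ∑ j, optCount E γ μ k j = T2 E γ μ k := by
  have lt_iff : ∀ j, μ j > γ ↔ μ j > μ k := fun j =>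
    ⟨hk.1.trans, fun h => (hμ.2.1 j).lt_or_gt.resolve_left fun hj => (hk.2 j hj).not_gt h⟩
  simp only [optCount, T2, Finset.sum_add_distrib, ← Finset.sum_filter, lt_iff,
    div_eq_inv_mul, mul_one, ← Finset.mul_sum]
  rw [add_comm]

theorem T2_pos (hγ : γ ∈ E.means) (hμ : μ ∈ instances E γ) (hk : IsPackingSlice γ μ k) :
    0 < T2 E γ μ k := by
  rw [← sum_optCount hμ hk]
  refine Finset.sum_pos' (fun j _ => optCount_nonneg hγ hμ hk j) ⟨k, Finset.mem_univ k, ?_⟩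
  exact (optCount_self hk.1).symm ▸ one_div_pos.2 (zStar_pos hγ hμ.1 hk.1.ne)

/-- The number of measurements of slice `j` in `w` beyond those in the optimal counts that collect
`r` units of information. -/
def excess (E : ExpFamily) (γ : ℝ) (μ : Fin K → ℝ) (k : Fin K) (w : Fin K → ℝ) (r : ℝ)
    (j : Fin K) : ℝ :=
  w j - r * optCount E γ μ k j

theorem sum_excess (hμ : μ ∈ instances E γ) (hk : IsPackingSlice γ μ k) (w : Fin K → ℝ) (r : ℝ) :
    ∑ j, excess E γ μ k w r j = ∑ j, w j - T2 E γ μ k * r := by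
  simp only [excess]
  rw [Finset.sum_sub_distrib, ← Finset.mul_sum, sum_optCount hμ hk, mul_comm]

-- The right-hand side groups the excesses into multiples of the slacks of the constraints; the
-- equilibrium equation `F = 1` makes the multiplier of the constraint on slice `k` vanish.
theorem sum_excess_eq_sum_slack (hμ : μ ∈ instances E γ) (hk : IsPackingSlice γ μ k) :
    ∑ j, excess E γ μ k w r j = ∑ j with γ < μ j, excess E γ μ k w r j +
      ((1 - F E μ k (lessLoaded μ k) (zStar E γ μ k)) * excess E γ μ k w r k +
        ∑ j ∈ lessLoaded μ k, (excess E γ μ k w r j +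
          mixRatio E μ j k (xStar E γ μ k j) * excess E γ μ k w r k)) := by
  have F_eq : F E μ k (lessLoaded μ k) (zStar E γ μ k) =
    ∑ j ∈ lessLoaded μ k, mixRatio E μ j k (xStar E γ μ k j) := rfl
  rw [sum_eq_sum_add_sum_lessLoaded hμ hk, Finset.sum_add_distrib, ← Finset.sum_mul, ← F_eq]
  ring

theorem excess_nonneg_of_gt (hγ : γ ∈ E.means) (hm : ∀ i, μ i ∈ E.means) (hk : μ k < γ)
    (hr : r ∈ lowerBounds (cost E μ w '' alt E γ k.succ)) (hj : γ < μ j) :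
    0 ≤ excess E γ μ k w r j := by
  rw [excess, optCount_of_gt hj, mul_one_div, sub_nonneg,
    div_le_iff₀ (ExpFamily.d_pos (hm j) hγ hj.ne')]
  exact le_mul_d_of_ne hγ hm hk (ne_of_apply_ne μ (hk.trans hj).ne') hr

theorem one_sub_F_mul_excess_nonneg (hγ : γ ∈ E.means) (hm : ∀ i, μ i ∈ E.means) (hk : μ k < γ)
    (hr : r ∈ lowerBounds (cost E μ w '' alt E γ k.succ)) :
    0 ≤ (1 - F E μ k (lessLoaded μ k) (zStar E γ μ k)) * excess E γ μ k w r k := by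
  rcases F_zStar hγ hm hk.ne with F_eq_one | ⟨F_lt_one, zStar_eq⟩
  · rw [F_eq_one, sub_self, zero_mul]
  · refine mul_nonneg (sub_pos.2 F_lt_one).le ?_
    rw [excess, optCount_self hk, mul_one_div, sub_nonneg, div_le_iff₀ (zStar_pos hγ hm hk.ne),
      zStar_eq]
    exact le_mul_d_packing hγ hm hr

theorem excess_add_mixRatio_mul_excess (hγ : γ ∈ E.means) (hm : ∀ i, μ i ∈ E.means)
    (hk : μ k < γ) (hj : j ∈ lessLoaded μ k) :
    excess E γ μ k w r j + mixRatio E μ j k (xStar E γ μ k j) * excess E γ μ k w r k =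
      (w k * E.d (μ k) (mStar E γ μ k j) + w j * E.d (μ j) (mStar E γ μ k j) - r) /
        E.d (μ j) (mStar E γ μ k j) := by
  have d_ne_zero := (d_mStar_pos hγ hm hk.ne hj).ne'
  have z_ne_zero := (zStar_pos hγ hm hk.ne).ne'
  have zStar_eq := g_xStar hγ hm hk.ne hj
  rw [excess, excess, optCount_lessLoaded hk hj, optCount_self hk, mixRatio, ← mStar]
  rw [g, ← mStar] at zStar_eq
  field_simp
  linear_combination -r * zStar_eq

theorem excess_add_mixRatio_mul_excess_nonneg (hγ : γ ∈ E.means) (hm : ∀ i, μ i ∈ E.means)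
    (hk : μ k < γ) (hr : r ∈ lowerBounds (cost E μ w '' alt E γ k.succ))
    (hj : j ∈ lessLoaded μ k) :
    0 ≤ excess E γ μ k w r j + mixRatio E μ j k (xStar E γ μ k j) * excess E γ μ k w r k := by
  rw [excess_add_mixRatio_mul_excess hγ hm hk hj]
  exact div_nonneg (sub_nonneg.2 (le_mul_d_mStar_add hγ hm hk hr hj)) (ExpFamily.d_nonneg _ _)

theorem T2_mul_le_sum (hγ : γ ∈ E.means) (hμ : μ ∈ instances E γ) (hk : IsPackingSlice γ μ k)
    (hr : r ∈ lowerBounds (cost E μ w '' alt E γ k.succ)) : T2 E γ μ k * r ≤ ∑ j, w j := by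
  rw [← sub_nonneg, ← sum_excess hμ hk, sum_excess_eq_sum_slack hμ hk]
  exact add_nonneg
    (Finset.sum_nonneg fun j hj =>
      excess_nonneg_of_gt hγ hμ.1 hk.1 hr ((Finset.mem_filter_univ j).1 hj))
    (add_nonneg (one_sub_F_mul_excess_nonneg hγ hμ.1 hk.1 hr)
      (Finset.sum_nonneg fun j => excess_add_mixRatio_mul_excess_nonneg hγ hμ.1 hk.1 hr))

theorem eq_xStar_mul_of_tight (hγ : γ ∈ E.means) (hm : ∀ i, μ i ∈ E.means) (hk : μ k < γ)
    (hwk : 0 ≤ w k) (hwj : 0 ≤ w j) (hr0 : 0 < r)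
    (hr : r ∈ lowerBounds (cost E μ w '' alt E γ k.succ)) (hj : j ∈ lessLoaded μ k)
    (tight : w k * E.d (μ k) (mStar E γ μ k j) + w j * E.d (μ j) (mStar E γ μ k j) = r) :
    w j = xStar E γ μ k j * w k := by
  have hlt := mem_lessLoaded.1 hj
  have sum_pos : 0 < w k + w j := by
    refine (add_nonneg hwk hwj).lt_of_ne' fun sum_zero => hr0.ne ?_
    obtain ⟨wk_zero, wj_zero⟩ := (add_eq_zero_iff_of_nonneg hwk hwj).1 sum_zero
    rw [← tight, wk_zero, wj_zero, zero_mul, zero_mul, add_zero]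
  obtain ⟨hc, hcγ⟩ := convex_iff_div.1
    (ExpFamily.ordConnected_means.convex.inter (convex_Iio γ)) ⟨hm k, hk⟩
    ⟨hm j, hlt.trans hk⟩ hwk hwj sum_pos
  refine eq_mul_of_weighted_d_le (hm j) (hm k) hlt.ne (xStar_nonneg hγ hm hk.ne hj) hc sum_pos ?_
    (tight.trans_le (le_mul_d_add_mul_d hm hc hcγ (ne_of_apply_ne μ hlt.ne) hr))
  rw [smul_eq_mul, smul_eq_mul]
  field_simp

theorem excess_self_eq_zero_of_tight (hγ : γ ∈ E.means) (hm : ∀ i, μ i ∈ E.means) (hk : μ k < γ)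
    (hj : j ∈ lessLoaded μ k) (hw : w j = xStar E γ μ k j * w k)
    (tight : w k * E.d (μ k) (mStar E γ μ k j) + w j * E.d (μ j) (mStar E γ μ k j) = r) :
    excess E γ μ k w r k = 0 := by
  rw [excess, optCount_self hk, mul_one_div, sub_eq_zero, eq_div_iff (zStar_pos hγ hm hk.ne).ne',
    ← g_xStar hγ hm hk.ne hj, g, ← mStar, ← tight, hw]
  ring

-- Complementary slackness: the nonnegative terms of `sum_excess_eq_sum_slack` all vanish.
theorem eq_smul_optCount_of_sum_eq (hγ : γ ∈ E.means) (hμ : μ ∈ instances E γ)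
    (hk : IsPackingSlice γ μ k) (hw : ∀ i, 0 ≤ w i) (hr0 : 0 < r)
    (hr : r ∈ lowerBounds (cost E μ w '' alt E γ k.succ))
    (hsum : ∑ j, w j = T2 E γ μ k * r) : w = r • optCount E γ μ k := by
  suffices excess_eq_zero : ∀ j, excess E γ μ k w r j = 0 from
    funext fun j => sub_eq_zero.1 (excess_eq_zero j)
  have unavailable_nonneg : ∀ j ∈ ({j | γ < μ j} : Finset (Fin K)), 0 ≤ excess E γ μ k w r j :=
    fun j hj => excess_nonneg_of_gt hγ hμ.1 hk.1 hr ((Finset.mem_filter_univ j).1 hj)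
  have pair_nonneg := fun j => excess_add_mixRatio_mul_excess_nonneg (j := j) hγ hμ.1 hk.1 hr
  have packing_nonneg := one_sub_F_mul_excess_nonneg hγ hμ.1 hk.1 hr
  have sum_slack := sum_excess_eq_sum_slack (w := w) (r := r) hμ hk
  rw [sum_excess hμ hk, hsum, sub_self, eq_comm, add_eq_zero_iff_of_nonneg
    (Finset.sum_nonneg unavailable_nonneg)
    (add_nonneg packing_nonneg (Finset.sum_nonneg pair_nonneg)),
    add_eq_zero_iff_of_nonneg packing_nonneg (Finset.sum_nonneg pair_nonneg),
    Finset.sum_eq_zero_iff_of_nonneg unavailable_nonneg,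
    Finset.sum_eq_zero_iff_of_nonneg pair_nonneg] at sum_slack
  obtain ⟨unavailable_zero, packing_zero, pair_zero⟩ := sum_slack
  have tight : ∀ j ∈ lessLoaded μ k,
      w k * E.d (μ k) (mStar E γ μ k j) + w j * E.d (μ j) (mStar E γ μ k j) = r := by
    intro j hj
    have slack_zero := pair_zero j hj
    rw [excess_add_mixRatio_mul_excess hγ hμ.1 hk.1 hj] at slack_zero
    exact sub_eq_zero.1 ((div_eq_zero_iff.1 slack_zero).resolve_right
      (d_mStar_pos hγ hμ.1 hk.1.ne hj).ne')
  have excess_self : excess E γ μ k w r k = 0 := by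
    rcases (lessLoaded μ k).eq_empty_or_nonempty with hL | ⟨j, hj⟩
    · rwa [hL, F, Finset.sum_empty, sub_zero, one_mul] at packing_zero
    · exact excess_self_eq_zero_of_tight hγ hμ.1 hk.1 hj
        (eq_xStar_mul_of_tight hγ hμ.1 hk.1 (hw k) (hw j) hr0 hr hj (tight j hj)) (tight j hj)
  intro j
  rcases slice_trichotomy hμ hk j with hj | rfl | hj
  · exact unavailable_zero j ((Finset.mem_filter_univ j).2 hj)
  · exact excess_self
  · simpa only [excess_self, mul_zero, add_zero] using pair_zero j hj

theorem mul_d_le_cost (hw : ∀ i, 0 ≤ w i) (j : Fin K) : w j * E.d (μ j) (ν j) ≤ cost E μ w ν :=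
  Finset.single_le_sum (f := fun i => w i * E.d (μ i) (ν i))
    (fun i _ => mul_nonneg (hw i) (ExpFamily.d_nonneg _ _)) (Finset.mem_univ j)

theorem mul_d_add_mul_d_le_cost (hw : ∀ i, 0 ≤ w i) (hjk : j ≠ k) :
    w k * E.d (μ k) (ν k) + w j * E.d (μ j) (ν j) ≤ cost E μ w ν := by
  rw [← Finset.sum_pair (f := fun i => w i * E.d (μ i) (ν i)) hjk.symm]
  exact Finset.sum_le_sum_of_subset_of_nonneg (Finset.subset_univ _) fun i _ _ =>
    mul_nonneg (hw i) (ExpFamily.d_nonneg _ _)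

theorem exists_lt_of_mem_alt (hν : ν ∈ alt E γ k.succ) :
    γ < ν k ∨ ∃ j, ν j < γ ∧ ν k < ν j := by
  obtain ⟨hν, hνk⟩ := mem_alt_succ.1 hν
  refine (hν.2.1 k).gt_or_lt.imp_right fun hk => ?_
  by_contra! h
  exact hνk ⟨hk, h⟩

theorem one_le_cost_optCount (hγ : γ ∈ E.means) (hμ : μ ∈ instances E γ)
    (hk : IsPackingSlice γ μ k) (hν : ν ∈ alt E γ k.succ) :
    1 ≤ cost E μ (optCount E γ μ k) ν := by
  have hνm := (mem_alt_succ.1 hν).1.1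
  have hz := zStar_pos hγ hμ.1 hk.1.ne
  have nonneg := optCount_nonneg hγ hμ hk
  rcases exists_lt_of_mem_alt hν with hγk | ⟨j, hjγ, hkj⟩
  · refine le_trans ?_ (mul_d_le_cost nonneg k)
    rw [optCount_self hk.1, one_div_mul_eq_div, one_le_div hz]
    exact zStar_le.trans ((ExpFamily.strictMonoOn_d (hμ.1 k)).monotoneOn ⟨hγ, hk.1.le⟩
      ⟨hνm k, (hk.1.trans hγk).le⟩ hγk.le)
  rcases slice_trichotomy hμ hk j with hj | rfl | hj
  · refine le_trans ?_ (mul_d_le_cost nonneg j)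
    rw [optCount_of_gt hj, one_div_mul_eq_div, one_le_div (ExpFamily.d_pos (hμ.1 j) hγ hj.ne')]
    exact (ExpFamily.strictAntiOn_d (hμ.1 j)).antitoneOn ⟨hνm j, (hjγ.trans hj).le⟩
      ⟨hγ, hj.le⟩ hjγ.le
  · exact absurd hkj (lt_irrefl _)
  · have hlt := mem_lessLoaded.1 hj
    refine le_trans ?_ (mul_d_add_mul_d_le_cost nonneg (ne_of_apply_ne μ hlt.ne))
    rw [optCount_self hk.1, optCount_lessLoaded hk.1 hj, one_div_mul_eq_div, div_mul_eq_mul_div,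
      ← add_div, one_le_div hz, ← g_xStar hγ hμ.1 hk.1.ne hj]
    exact g_le_of_lt (hμ.1 j) (hμ.1 k) hlt (xStar_nonneg hγ hμ.1 hk.1.ne hj) (hνm k) (hνm j) hkj

theorem alt_nonempty (hγ : γ ∈ E.means) (hμ : μ ∈ instances E γ) (hk : IsPackingSlice γ μ k) :
    (alt E γ k.succ).Nonempty := by
  by_contra empty
  have T2_le_zero := T2_mul_le_sum (w := 0) (r := 1) hγ hμ hk (by
    rw [not_nonempty_iff_eq_empty.1 empty, image_empty, lowerBounds_empty]
    trivial)
  rw [mul_one, Finset.sum_eq_zero fun _ _ => Pi.zero_apply _] at T2_le_zero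
  exact (T2_pos hγ hμ hk).not_ge T2_le_zero

theorem rate_mem_lowerBounds (hw : ∀ i, 0 ≤ w i) :
    rate E γ μ k.succ w ∈ lowerBounds (cost E μ w '' alt E γ k.succ) := by
  refine fun _ h => csInf_le ⟨0, ?_⟩ h
  rintro _ ⟨ν, -, rfl⟩
  exact Finset.sum_nonneg fun i _ => mul_nonneg (hw i) (ExpFamily.d_nonneg _ _)

theorem rate_le_inv_T2 (hγ : γ ∈ E.means) (hμ : μ ∈ instances E γ) (hk : IsPackingSlice γ μ k)
    (hw : w ∈ stdSimplex ℝ (Fin K)) : rate E γ μ k.succ w ≤ (T2 E γ μ k)⁻¹ := by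
  rw [← one_div, le_div_iff₀' (T2_pos hγ hμ hk), ← hw.2]
  exact T2_mul_le_sum hγ hμ hk (rate_mem_lowerBounds hw.1)

theorem wStar_mem_stdSimplex (hγ : γ ∈ E.means) (hμ : μ ∈ instances E γ)
    (hk : IsPackingSlice γ μ k) : wStar E γ μ k ∈ stdSimplex ℝ (Fin K) := by
  have hT := T2_pos hγ hμ hk
  rw [wStar_eq]
  refine ⟨fun j => mul_nonneg (inv_pos.2 hT).le (optCount_nonneg hγ hμ hk j), ?_⟩
  simp only [Pi.smul_apply, smul_eq_mul]
  rw [← Finset.mul_sum, sum_optCount hμ hk, inv_mul_cancel₀ hT.ne']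

theorem cost_smul (c : ℝ) : cost E μ (c • w) ν = c * cost E μ w ν := by
  simp only [cost, Pi.smul_apply, smul_eq_mul, mul_assoc, Finset.mul_sum]

theorem rate_wStar (hγ : γ ∈ E.means) (hμ : μ ∈ instances E γ) (hk : IsPackingSlice γ μ k) :
    rate E γ μ k.succ (wStar E γ μ k) = (T2 E γ μ k)⁻¹ := by
  refine le_antisymm (rate_le_inv_T2 hγ hμ hk (wStar_mem_stdSimplex hγ hμ hk)) ?_
  refine le_csInf ((alt_nonempty hγ hμ hk).image _) (forall_mem_image.2 fun ν hν => ?_)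
  change _ ≤ cost E μ (wStar E γ μ k) ν
  rw [wStar_eq, cost_smul]
  exact le_mul_of_one_le_right (inv_pos.2 (T2_pos hγ hμ hk)).le
    (one_le_cost_optCount hγ hμ hk hν)

theorem eq_wStar_of_rate_eq (hγ : γ ∈ E.means) (hμ : μ ∈ instances E γ)
    (hk : IsPackingSlice γ μ k) (hw : w ∈ stdSimplex ℝ (Fin K))
    (hr : rate E γ μ k.succ w = (T2 E γ μ k)⁻¹) : w = wStar E γ μ k := by
  have hT := T2_pos hγ hμ hk
  rw [wStar_eq]
  exact eq_smul_optCount_of_sum_eq hγ hμ hk hw.1 (inv_pos.2 hT) (hr ▸ rate_mem_lowerBounds hw.1)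
    (by rw [hw.2, mul_inv_cancel₀ hT.ne'])

theorem setOf_isMaxOn_rate (hγ : γ ∈ E.means) (hμ : μ ∈ instances E γ)
    (hk : IsPackingSlice γ μ k) : {w : Fin K → ℝ | w ∈ stdSimplex ℝ (Fin K) ∧
    IsMaxOn (rate E γ μ k.succ) (stdSimplex ℝ (Fin K)) w} = {wStar E γ μ k} := by
  have wStar_mem := wStar_mem_stdSimplex hγ hμ hk
  refine eq_singleton_iff_unique_mem.2 ⟨⟨wStar_mem, fun w hw => ?_⟩, fun w ⟨hw, isMax⟩ => ?_⟩
  · exact (rate_le_inv_T2 hγ hμ hk hw).trans_eq (rate_wStar hγ hμ hk).symm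
  · exact eq_wStar_of_rate_eq hγ hμ hk hw (le_antisymm (rate_le_inv_T2 hγ hμ hk hw)
      ((rate_wStar hγ hμ hk).symm.trans_le (isMax wStar_mem)))

end Duality

/-! ### Change of measure -/

section Independence

variable {K : ℕ} {E : ExpFamily} {μ : Fin K → ℝ}

theorem isProbabilityMeasure_pi_law (hm : ∀ i, μ i ∈ E.means) :
    IsProbabilityMeasure (Measure.pi fun i => E.law (μ i)) := by
  have := fun i => ExpFamily.isProbabilityMeasure_law (hm i)
  infer_instance

theorem isProbabilityMeasure_obsLaw (hm : ∀ i, μ i ∈ E.means) :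
    IsProbabilityMeasure (obsLaw E μ) := by
  have := isProbabilityMeasure_pi_law hm
  unfold obsLaw
  infer_instance

theorem measurable_obs (t : ℕ) (j : Fin K) : Measurable fun ω : Obs K => ω t j :=
  (measurable_pi_apply j).comp (measurable_pi_apply t)

theorem map_obs_obsLaw (hm : ∀ i, μ i ∈ E.means) (t : ℕ) (j : Fin K) :
    (obsLaw E μ).map (fun ω => ω t j) = E.law (μ j) := by
  have := fun i => ExpFamily.isProbabilityMeasure_law (hm i)
  have map_slot : (obsLaw E μ).map (fun ω => ω t) = Measure.pi fun i => E.law (μ i) :=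
    Measure.infinitePi_map_eval _ t
  have obs_eq_comp : (fun ω : Obs K => ω t j) = (fun x : Fin K → ℝ => x j) ∘ fun ω => ω t := rfl
  rw [obs_eq_comp, ← Measure.map_map (measurable_pi_apply j) (measurable_pi_apply t), map_slot]
  exact (measurePreserving_eval (fun i => E.law (μ i)) j).map_eq

/-- The σ-algebra of the measurements of all slices in slot `t + 1`, observed or not. -/
@[reducible]
def slotSpace (K : ℕ) (t : ℕ) : MeasurableSpace (Obs K) :=
  MeasurableSpace.comap (fun ω : Obs K => ω t) MeasurableSpace.pi

theorem slotSpace_le (t : ℕ) : slotSpace K t ≤ MeasurableSpace.pi :=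
  (measurable_pi_apply t).comap_le

theorem measurable_slotSpace_obs (t : ℕ) (j : Fin K) :
    Measurable[slotSpace K t] fun ω : Obs K => ω t j :=
  (measurable_pi_apply j).comp (comap_measurable _)

namespace SamplingRule

variable (S : SamplingRule K)

theorem history_le (t : ℕ) : history S.arm t ≤ MeasurableSpace.pi :=
  S.filtration.le t

theorem history_le_iSup_slotSpace (t : ℕ) :
    history S.arm t ≤ ⨆ s ∈ Set.Iio t, slotSpace K s := by
  induction t using Nat.strong_induction_on with
  | _ t ih =>
    refine iSup₂_le fun s hs => ?_
    have measurable_arm : Measurable[⨆ s ∈ Set.Iio t, slotSpace K s] (S.arm s) :=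
      (S.adapted s).mono ((ih s hs).trans
        (biSup_mono fun i (hi : i < s) => hi.trans hs)) le_rfl
    have measurable_slot : Measurable[⨆ s ∈ Set.Iio t, slotSpace K s] fun ω : Obs K => ω s :=
      (comap_measurable _).mono (le_iSup₂_of_le s hs le_rfl) le_rfl
    refine sup_le measurable_arm.comap_le ?_
    rw [← (inferInstance : BorelSpace ℝ).measurable_eq]
    refine Measurable.comap_le ?_
    exact (measurable_from_prod_countable_left (f := fun p : (Fin K → ℝ) × Fin K => p.1 p.2)
      (fun k => measurable_pi_apply k)).comp (measurable_slot.prodMk measurable_arm)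

theorem indep_history_slotSpace (hm : ∀ i, μ i ∈ E.means) (t : ℕ) :
    Indep (history S.arm t) (slotSpace K t) (obsLaw E μ) := by
  have := isProbabilityMeasure_pi_law hm
  have iIndepFun_slot : iIndepFun (fun (t : ℕ) (ω : Obs K) => ω t) (obsLaw E μ) :=
    iIndepFun_infinitePi (X := fun _ x => x) fun _ => measurable_id
  have indep_past := indep_iSup_of_disjoint (S := Set.Iio t) (T := {t})
    (fun i => slotSpace_le i) iIndepFun_slot (by simp)
  exact indep_of_indep_of_le_left
    (indep_of_indep_of_le_right indep_past (le_iSup₂_of_le t (mem_singleton t) le_rfl))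
    (S.history_le_iSup_slotSpace t)

theorem measurableSet_arm_eq (t : ℕ) (j : Fin K) :
    MeasurableSet[history S.arm t] {ω | S.arm t ω = j} :=
  S.adapted t (measurableSet_singleton j)

theorem measurable_comp_obs_arm {s t : ℕ} (hst : s < t) {β : Type*} [MeasurableSpace β]
    {φ : Fin K → ℝ → β} (hφ : ∀ j, Measurable (φ j)) :
    Measurable[history S.arm t] fun ω => φ (S.arm s ω) (ω s (S.arm s ω)) := by
  have measurable_arm : Measurable[history S.arm t] (S.arm s) :=
    (S.adapted s).mono (history_mono S.arm hst.le) le_rfl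
  have measurable_value : Measurable[history S.arm t] fun ω => ω s (S.arm s ω) := by
    rw [measurable_iff_comap_le, (inferInstance : BorelSpace ℝ).measurable_eq]
    exact le_sup_right.trans (le_iSup₂_of_le s hst le_rfl)
  exact (measurable_from_prod_countable_left (f := fun p : ℝ × Fin K => φ p.2 p.1)
    (fun k => hφ k)).comp (measurable_value.prodMk measurable_arm)

theorem lintegral_mul_obs (hm : ∀ i, μ i ∈ E.means) {t : ℕ} {f : Obs K → ℝ≥0∞}
    (hf : Measurable[history S.arm t] f) {h : ℝ → ℝ≥0∞} (hh : Measurable h) (j : Fin K) :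
    ∫⁻ ω, f ω * h (ω t j) ∂(obsLaw E μ) =
      (∫⁻ ω, f ω ∂(obsLaw E μ)) * ∫⁻ x, h x ∂(E.law (μ j)) := by
  rw [← map_obs_obsLaw hm t j, lintegral_map hh (measurable_obs t j)]
  exact lintegral_mul_eq_lintegral_mul_lintegral_of_independent_measurableSpace (S.history_le t)
    (slotSpace_le t) (S.indep_history_slotSpace hm t) hf (hh.comp (measurable_slotSpace_obs t j))

theorem lintegral_mul_obs_arm (hm : ∀ i, μ i ∈ E.means) {t : ℕ} {f : Obs K → ℝ≥0∞}
    (hf : Measurable[history S.arm t] f) {h : Fin K → ℝ → ℝ≥0∞} (hh : ∀ j, Measurable (h j)) :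
    ∫⁻ ω, f ω * h (S.arm t ω) (ω t (S.arm t ω)) ∂(obsLaw E μ) =
      ∑ j, (∫⁻ ω in {ω | S.arm t ω = j}, f ω ∂(obsLaw E μ)) * ∫⁻ x, h j x ∂(E.law (μ j)) := by
  have hA := S.measurableSet_arm_eq t
  have sum_over_arms : ∀ ω, f ω * h (S.arm t ω) (ω t (S.arm t ω)) =
      ∑ j, {ω | S.arm t ω = j}.indicator f ω * h j (ω t j) := by
    intro ω
    rw [Finset.sum_eq_single (S.arm t ω)]
    · simp
    · intro j _ hj
      rw [indicator_of_notMem (by simpa using hj.symm), zero_mul]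
    · simp
  simp_rw [sum_over_arms]
  rw [lintegral_finsetSum]
  · refine Finset.sum_congr rfl fun j _ => ?_
    rw [S.lintegral_mul_obs hm (hf.indicator (hA j)) (hh j),
      lintegral_indicator (S.history_le t _ (hA j))]
  · intro j _
    exact ((hf.indicator (hA j)).mono (S.history_le t) le_rfl).mul
      ((hh j).comp (measurable_obs t j))

theorem setLIntegral_mul_obs_arm (hm : ∀ i, μ i ∈ E.means) {t : ℕ} {f : Obs K → ℝ≥0∞}
    (hf : Measurable[history S.arm t] f) {h : Fin K → ℝ → ℝ≥0∞} (hh : ∀ j, Measurable (h j))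
    {A : Set (Obs K)} (hA : MeasurableSet[history S.arm t] A) {B : Set ℝ} (hB : MeasurableSet B) :
    ∫⁻ ω in A ∩ {ω | ω t (S.arm t ω) ∈ B},
        f ω * h (S.arm t ω) (ω t (S.arm t ω)) ∂(obsLaw E μ) =
      ∑ j, (∫⁻ ω in A ∩ {ω | S.arm t ω = j}, f ω ∂(obsLaw E μ)) *
        ∫⁻ x in B, h j x ∂(E.law (μ j)) := by
  have measurableSet_obs : MeasurableSet {ω : Obs K | ω t (S.arm t ω) ∈ B} :=
    S.history_le (t + 1) _ (S.measurable_comp_obs_arm t.lt_succ_self (φ := fun _ x => x)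
      (fun _ => measurable_id) hB)
  have key := S.lintegral_mul_obs_arm hm (hf.indicator hA) fun j => (hh j).indicator hB
  simp only [setLIntegral_indicator (S.history_le t _ hA), lintegral_indicator hB] at key
  rw [← key, ← lintegral_indicator ((S.history_le t _ hA).inter measurableSet_obs)]
  refine lintegral_congr fun ω => ?_
  by_cases hω : ω ∈ A <;> by_cases hωB : ω t (S.arm t ω) ∈ B <;> simp [hω, hωB]

end SamplingRule

end Independence

namespace SamplingRule

section ChangeOfMeasure

variable {K : ℕ} {E : ExpFamily} {μ ν : Fin K → ℝ} (S : SamplingRule K)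

/-- The intersections of an event of the first `t` slots with an event that restricts the value
observed in slot `t + 1`; they form a π-system that generates the history of `t + 1` slots. -/
def rectangles (t : ℕ) : Set (Set (Obs K)) :=
  {s | ∃ A B, MeasurableSet[history S.arm t] A ∧ MeasurableSet B ∧
    s = A ∩ {ω | ω t (S.arm t ω) ∈ B}}

theorem isPiSystem_rectangles (t : ℕ) : IsPiSystem (S.rectangles t) := by
  rintro _ ⟨A, B, hA, hB, rfl⟩ _ ⟨A', B', hA', hB', rfl⟩ -
  refine ⟨A ∩ A', B ∩ B', hA.inter hA', hB.inter hB', ?_⟩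
  rw [inter_inter_inter_comm]
  rfl

theorem history_succ (t : ℕ) :
    history S.arm (t + 1) = MeasurableSpace.generateFrom (S.rectangles t) := by
  have measurableSet_of_history : ∀ A, MeasurableSet[history S.arm t] A →
      MeasurableSet[MeasurableSpace.generateFrom (S.rectangles t)] A := fun A hA =>
    MeasurableSpace.measurableSet_generateFrom ⟨A, univ, hA, MeasurableSet.univ, by simp⟩
  refine le_antisymm (iSup₂_le fun s hs => ?_) (MeasurableSpace.generateFrom_le ?_)
  · rcases (Nat.lt_succ_iff.1 hs).lt_or_eq with hlt | rfl
    · exact (le_iSup₂_of_le (f := fun s (_ : s ∈ Set.Iio t) =>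
        MeasurableSpace.comap (S.arm s) ⊤ ⊔
          MeasurableSpace.comap (fun ω : Obs K => ω s (S.arm s ω)) (borel ℝ)) s hlt le_rfl).trans
        measurableSet_of_history
    · refine sup_le ((S.adapted s).comap_le.trans measurableSet_of_history) ?_
      rintro _ ⟨B, hB, rfl⟩
      rw [← (inferInstance : BorelSpace ℝ).measurable_eq] at hB
      exact MeasurableSpace.measurableSet_generateFrom
        ⟨univ, B, @MeasurableSet.univ _ (history S.arm s), hB, (univ_inter _).symm⟩
  · rintro _ ⟨A, B, hA, hB, rfl⟩
    exact (history_mono S.arm (Nat.le_succ t) _ hA).inter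
      (S.measurable_comp_obs_arm t.lt_succ_self (φ := fun _ x => x) (fun _ => measurable_id) hB)

theorem measure_eq_of_eq_on_rectangles {P Q : Measure (Obs K)} [IsFiniteMeasure P] {t : ℕ}
    (h : ∀ A B, MeasurableSet[history S.arm t] A → MeasurableSet B →
      P (A ∩ {ω | ω t (S.arm t ω) ∈ B}) = Q (A ∩ {ω | ω t (S.arm t ω) ∈ B}))
    {A : Set (Obs K)} (hA : MeasurableSet[history S.arm (t + 1)] A) : P A = Q A := by
  refine ext_on_measurableSpace_of_generate_finite _ (S.rectangles t) ?_ (S.history_le (t + 1))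
    (S.history_succ t) (S.isPiSystem_rectangles t) ?_ hA
  · rintro _ ⟨A, B, hA, hB, rfl⟩
    exact h A B hA hB
  · simpa using h univ univ (@MeasurableSet.univ _ (history S.arm t)) MeasurableSet.univ

/-- The log-likelihood ratio of the observation of slot `t + 1` under the loads `ν` and `μ`. -/
def obsLogRatio (E : ExpFamily) (μ ν : Fin K → ℝ) (t : ℕ) (ω : Obs K) : ℝ :=
  E.logRatio (μ (S.arm t ω)) (ν (S.arm t ω)) (ω t (S.arm t ω))

/-- The log-likelihood ratio of the first `t` observations under the loads `ν` and `μ`. -/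
def logLik (E : ExpFamily) (μ ν : Fin K → ℝ) (t : ℕ) (ω : Obs K) : ℝ :=
  ∑ s ∈ Finset.range t, S.obsLogRatio E μ ν s ω

theorem measurable_obsLogRatio (E : ExpFamily) (μ ν : Fin K → ℝ) {s t : ℕ} (hst : s < t) :
    Measurable[history S.arm t] (S.obsLogRatio E μ ν s) :=
  S.measurable_comp_obs_arm hst (φ := fun j x => E.logRatio (μ j) (ν j) x) fun _ =>
    ExpFamily.measurable_logRatio _ _

theorem measurable_logLik (E : ExpFamily) (μ ν : Fin K → ℝ) (t : ℕ) :
    Measurable[history S.arm t] (S.logLik E μ ν t) :=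
  Finset.measurable_sum _ fun _ hs => S.measurable_obsLogRatio E μ ν (Finset.mem_range.1 hs)

theorem ofReal_exp_logLik_succ (E : ExpFamily) (μ ν : Fin K → ℝ) (t : ℕ) (ω : Obs K) :
    ENNReal.ofReal (Real.exp (S.logLik E μ ν (t + 1) ω)) =
      ENNReal.ofReal (Real.exp (S.logLik E μ ν t ω)) *
        ENNReal.ofReal (Real.exp (S.obsLogRatio E μ ν t ω)) := by
  rw [logLik, Finset.sum_range_succ, ← logLik, Real.exp_add, ENNReal.ofReal_mul (Real.exp_pos _).le]

theorem obsLaw_apply_eq_setLIntegral (hm : ∀ i, μ i ∈ E.means) (hn : ∀ i, ν i ∈ E.means) (t : ℕ)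
    {A : Set (Obs K)} (hA : MeasurableSet[history S.arm t] A) :
    obsLaw E ν A = ∫⁻ ω in A, ENNReal.ofReal (Real.exp (S.logLik E μ ν t ω)) ∂(obsLaw E μ) := by
  have := isProbabilityMeasure_obsLaw hm
  have := isProbabilityMeasure_obsLaw hn
  induction t generalizing A with
  | zero =>
    have history_zero : history S.arm 0 = ⊥ := by simp [history]
    rw [history_zero, MeasurableSpace.measurableSet_bot_iff] at hA
    rcases hA with rfl | rfl <;> simp [logLik]
  | succ t ih =>
    rw [← withDensity_apply _ (S.history_le (t + 1) _ hA)]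
    refine S.measure_eq_of_eq_on_rectangles (fun A B hA hB => ?_) hA
    have measurableSet_rectangle : MeasurableSet (A ∩ {ω | ω t (S.arm t ω) ∈ B}) := by
      refine S.history_le (t + 1) _ ?_
      rw [S.history_succ]
      exact MeasurableSpace.measurableSet_generateFrom ⟨A, B, hA, hB, rfl⟩
    calc obsLaw E ν (A ∩ {ω | ω t (S.arm t ω) ∈ B})
        = ∑ j, obsLaw E ν (A ∩ {ω | S.arm t ω = j}) * E.law (ν j) B := by
          simpa using S.setLIntegral_mul_obs_arm hn (f := 1)
            (@measurable_const _ _ _ (history S.arm t) 1) (h := 1) (fun _ => measurable_const) hA hB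
      _ = ∑ j, (∫⁻ ω in A ∩ {ω | S.arm t ω = j},
              ENNReal.ofReal (Real.exp (S.logLik E μ ν t ω)) ∂(obsLaw E μ)) *
            ∫⁻ x in B, ENNReal.ofReal (Real.exp (E.logRatio (μ j) (ν j) x)) ∂(E.law (μ j)) := by
          refine Finset.sum_congr rfl fun j _ => ?_
          rw [ih (hA.inter (S.measurableSet_arm_eq t j)),
            ExpFamily.law_eq_withDensity (hm j) (hn j), withDensity_apply _ hB]
      _ = ∫⁻ ω in A ∩ {ω | ω t (S.arm t ω) ∈ B},
            ENNReal.ofReal (Real.exp (S.logLik E μ ν (t + 1) ω)) ∂(obsLaw E μ) := by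
          simp_rw [ofReal_exp_logLik_succ]
          exact (S.setLIntegral_mul_obs_arm hm
            (Real.measurable_exp.comp (S.measurable_logLik E μ ν t)).ennreal_ofReal
            (fun j => (Real.measurable_exp.comp
              (ExpFamily.measurable_logRatio (μ j) (ν j))).ennreal_ofReal) hA hB).symm
      _ = _ := (withDensity_apply _ measurableSet_rectangle).symm

end ChangeOfMeasure

end SamplingRule

section Transportation

variable {Ω : Type*} [MeasurableSpace Ω] {P : Measure Ω} {M : Ω → ℝ}

theorem setIntegral_le_exp_mul_sub [IsProbabilityMeasure P] (hM : Integrable M P)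
    (hexp : Integrable (fun ω => Real.exp (M ω)) P) (B : Set Ω) (c : ℝ) :
    ∫ ω in B, M ω ∂P ≤ Real.exp c * ∫ ω in B, Real.exp (M ω) ∂P - (1 + c) * P.real B := by
  calc ∫ ω in B, M ω ∂P
      ≤ ∫ ω in B, (Real.exp c * Real.exp (M ω) - (1 + c)) ∂P := by
        refine integral_mono hM.restrict
          ((hexp.const_mul _).sub (integrable_const _)).restrict fun ω => ?_
        have := Real.add_one_le_exp (c + M ω)
        rw [Real.exp_add] at this
        linarith
    _ = Real.exp c * ∫ ω in B, Real.exp (M ω) ∂P - (1 + c) * P.real B := by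
        rw [integral_sub (hexp.const_mul _).restrict (integrable_const _), integral_const_mul,
          setIntegral_const, smul_eq_mul, mul_comm (P.real B)]

theorem log_mul_two_mul_measureReal_sub_one_le [IsProbabilityMeasure P] (hM : Integrable M P)
    (hexp : Integrable (fun ω => Real.exp (M ω)) P) (hone : ∫ ω, Real.exp (M ω) ∂P = 1)
    {B : Set Ω} (hB : MeasurableSet B) {δ : ℝ} (hδ : 0 < δ) (hδ2 : δ ≤ 1 / 2)
    (hBδ : ∫ ω in B, Real.exp (M ω) ∂P ≤ δ) :
    Real.log ((1 - δ) / δ) * (2 * P.real B - 1) ≤ -∫ ω, M ω ∂P := by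
  set ρ := (1 - δ) / δ with ρ_def
  have one_le_ρ : 1 ≤ ρ := by
    rw [ρ_def, le_div_iff₀ hδ]
    linarith
  have ρ_pos : 0 < ρ := one_pos.trans_le one_le_ρ
  -- `e^u ≥ 1 + u` at `u = M + log ρ` on `B`, and at `u = M - log ρ` off `B`
  have on_B := setIntegral_le_exp_mul_sub hM hexp B (Real.log ρ)
  have off_B := setIntegral_le_exp_mul_sub hM hexp Bᶜ (-Real.log ρ)
  rw [Real.exp_log ρ_pos] at on_B
  rw [Real.exp_neg, Real.exp_log ρ_pos, setIntegral_compl hB hexp, hone,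
    probReal_compl_eq_one_sub hB] at off_B
  have density_on_B : (ρ - ρ⁻¹) * ∫ ω in B, Real.exp (M ω) ∂P ≤ (ρ - ρ⁻¹) * δ :=
    mul_le_mul_of_nonneg_left hBδ (sub_nonneg.2 ((inv_le_one_of_one_le₀ one_le_ρ).trans one_le_ρ))
  have ρ_eq : ρ⁻¹ + (ρ - ρ⁻¹) * δ = 1 := by
    have : 1 - δ ≠ 0 := by linarith
    rw [ρ_def]
    field_simp
    ring
  have split := integral_add_compl hB hM
  linarith

end Transportation

namespace SamplingRule

section Stopped

variable {K : ℕ} {E : ExpFamily} {μ ν : Fin K → ℝ} (S : SamplingRule K)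

theorem integrable_logRatio_obs (hm : ∀ i, μ i ∈ E.means) (t : ℕ) (j : Fin K) (b : ℝ) :
    Integrable (fun ω : Obs K => E.logRatio (μ j) b (ω t j)) (obsLaw E μ) := by
  have := ExpFamily.integrable_logRatio (hm j) (μ j) b
  rw [← map_obs_obsLaw hm t j] at this
  exact this.comp_measurable (measurable_obs t j)

theorem integral_logRatio_obs (hm : ∀ i, μ i ∈ E.means) (t : ℕ) (j : Fin K) {b : ℝ}
    (hb : b ∈ E.means) : ∫ ω, E.logRatio (μ j) b (ω t j) ∂(obsLaw E μ) = -E.d (μ j) b := by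
  rw [← ExpFamily.integral_logRatio (hm j) hb, ← map_obs_obsLaw hm t j,
    integral_map (measurable_obs t j).aemeasurable
      (ExpFamily.measurable_logRatio _ _).aestronglyMeasurable]

theorem integrable_obsLogRatio (hm : ∀ i, μ i ∈ E.means) (ν : Fin K → ℝ) (t : ℕ) :
    Integrable (S.obsLogRatio E μ ν t) (obsLaw E μ) := by
  have integrable_sum : Integrable
      (fun ω : Obs K => ∑ j, |E.logRatio (μ j) (ν j) (ω t j)|) (obsLaw E μ) :=
    integrable_finsetSum _ fun j _ => (integrable_logRatio_obs hm t j (ν j)).abs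
  refine integrable_sum.mono' ((S.measurable_obsLogRatio E μ ν t.lt_succ_self).mono
    (S.history_le (t + 1)) le_rfl).aestronglyMeasurable (Filter.Eventually.of_forall fun ω => ?_)
  exact Finset.single_le_sum (f := fun j => |E.logRatio (μ j) (ν j) (ω t j)|)
    (fun _ _ => abs_nonneg _) (Finset.mem_univ (S.arm t ω))

theorem setIntegral_logRatio_obs (hm : ∀ i, μ i ∈ E.means) {t : ℕ} {A : Set (Obs K)}
    (hA : MeasurableSet[history S.arm t] A) (j : Fin K) {b : ℝ} (hb : b ∈ E.means) :
    ∫ ω in A, E.logRatio (μ j) b (ω t j) ∂(obsLaw E μ) = -((obsLaw E μ).real A * E.d (μ j) b) := by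
  have := isProbabilityMeasure_obsLaw hm
  have indep_obs : Indep (history S.arm t)
      (MeasurableSpace.comap (fun ω : Obs K => ω t j) inferInstance) (obsLaw E μ) :=
    indep_of_indep_of_le_right (S.indep_history_slotSpace hm t)
      (measurable_slotSpace_obs t j).comap_le
  rw [indep_obs.setIntegral_eq_mul (S.history_le t) (measurable_obs t j).aemeasurable hA
    (ExpFamily.measurable_logRatio _ _).aestronglyMeasurable, integral_logRatio_obs hm t j hb,
    mul_neg]

theorem setIntegral_obsLogRatio (hm : ∀ i, μ i ∈ E.means) (hn : ∀ i, ν i ∈ E.means) {t : ℕ}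
    {A : Set (Obs K)} (hA : MeasurableSet[history S.arm t] A) :
    ∫ ω in A, S.obsLogRatio E μ ν t ω ∂(obsLaw E μ) =
      -∑ j, (obsLaw E μ).real (A ∩ {ω | S.arm t ω = j}) * E.d (μ j) (ν j) := by
  have hAj := fun j => hA.inter (S.measurableSet_arm_eq t j)
  have A_eq_iUnion : A = ⋃ j, A ∩ {ω | S.arm t ω = j} := by
    ext ω
    simp
  calc ∫ ω in A, S.obsLogRatio E μ ν t ω ∂(obsLaw E μ)
      = ∑ j, ∫ ω in A ∩ {ω | S.arm t ω = j}, S.obsLogRatio E μ ν t ω ∂(obsLaw E μ) := by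
        conv_lhs => rw [A_eq_iUnion]
        exact integral_iUnion_fintype (fun j => S.history_le t _ (hAj j))
          (fun i j hij => Set.disjoint_left.2 fun ω hi hj => hij (hi.2.symm.trans hj.2))
          fun j => (S.integrable_obsLogRatio hm ν t).integrableOn
    _ = ∑ j, ∫ ω in A ∩ {ω | S.arm t ω = j}, E.logRatio (μ j) (ν j) (ω t j) ∂(obsLaw E μ) :=
        Finset.sum_congr rfl fun j _ => setIntegral_congr_fun (S.history_le t _ (hAj j))
          (by rintro ω ⟨-, rfl⟩; rfl)
    _ = -∑ j, (obsLaw E μ).real (A ∩ {ω | S.arm t ω = j}) * E.d (μ j) (ν j) := by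
        rw [← Finset.sum_neg_distrib]
        exact Finset.sum_congr rfl fun j _ => S.setIntegral_logRatio_obs hm (hAj j) j (hn j)

/-- The expected number of measurements of slice `j` among the first `n` slots, up to the
stopping time `σ`. -/
def expectedCount (E : ExpFamily) (μ : Fin K → ℝ) (σ : Obs K → ℕ∞) (n : ℕ) (j : Fin K) : ℝ :=
  ∑ s ∈ Finset.range n, (obsLaw E μ).real ({ω | (s : ℕ∞) < σ ω} ∩ {ω | S.arm s ω = j})

variable {S} {σ : Obs K → ℕ∞} {n : ℕ}

theorem measurableSet_lt_stop (hσ : IsStoppingTime S.filtration σ) (s : ℕ) :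
    MeasurableSet[history S.arm s] {ω | (s : ℕ∞) < σ ω} :=
  hσ.measurableSet_gt s

theorem stoppedValue_logLik_eq_sum (hσn : ∀ ω, σ ω ≤ n) (ω : Obs K) :
    stoppedValue (S.logLik E μ ν) σ ω =
      ∑ s ∈ Finset.range n, {ω | (s : ℕ∞) < σ ω}.indicator (S.obsLogRatio E μ ν s) ω := by
  obtain ⟨m, hm⟩ := ENat.ne_top_iff_exists.1 (ne_top_of_le_ne_top (ENat.natCast_ne_top n) (hσn ω))
  have m_le_n : m ≤ n := by exact_mod_cast hm ▸ hσn ω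
  have stopped_at_m : stoppedValue (S.logLik E μ ν) σ ω = S.logLik E μ ν m ω := by
    simp only [stoppedValue, ← hm]
    rfl
  simp only [stopped_at_m, logLik, indicator_apply, mem_ofPred_eq, ← hm, Nat.cast_lt,
    ← Finset.sum_filter]
  congr 1
  ext s
  simp only [Finset.mem_range, Finset.mem_filter]
  omega

theorem integrable_stoppedValue_logLik (hm : ∀ i, μ i ∈ E.means) (ν : Fin K → ℝ)
    (hσ : IsStoppingTime S.filtration σ) (hσn : ∀ ω, σ ω ≤ n) :
    Integrable (stoppedValue (S.logLik E μ ν) σ) (obsLaw E μ) := by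
  rw [funext (stoppedValue_logLik_eq_sum hσn)]
  exact integrable_finsetSum _ fun s _ => (S.integrable_obsLogRatio hm ν s).indicator
    (S.history_le s _ (measurableSet_lt_stop hσ s))

theorem integral_stoppedValue_logLik (hm : ∀ i, μ i ∈ E.means) (hn : ∀ i, ν i ∈ E.means)
    (hσ : IsStoppingTime S.filtration σ) (hσn : ∀ ω, σ ω ≤ n) :
    ∫ ω, stoppedValue (S.logLik E μ ν) σ ω ∂(obsLaw E μ) =
      -∑ j, S.expectedCount E μ σ n j * E.d (μ j) (ν j) := by
  have hlt := fun s => S.history_le s _ (measurableSet_lt_stop hσ s)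
  simp_rw [stoppedValue_logLik_eq_sum hσn, expectedCount, Finset.sum_mul]
  rw [integral_finsetSum _ fun s _ => (S.integrable_obsLogRatio hm ν s).indicator (hlt s),
    Finset.sum_comm, ← Finset.sum_neg_distrib]
  refine Finset.sum_congr rfl fun s _ => ?_
  rw [integral_indicator (hlt s), S.setIntegral_obsLogRatio hm hn (measurableSet_lt_stop hσ s)]

theorem obsLaw_apply_eq_setLIntegral_stoppedValue (hm : ∀ i, μ i ∈ E.means)
    (hn : ∀ i, ν i ∈ E.means) (hσ : IsStoppingTime S.filtration σ) (hσ_top : ∀ ω, σ ω ≠ ⊤)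
    {B : Set (Obs K)} (hB : MeasurableSet[hσ.measurableSpace] B) :
    obsLaw E ν B = ∫⁻ ω in B,
      ENNReal.ofReal (Real.exp (stoppedValue (S.logLik E μ ν) σ ω)) ∂(obsLaw E μ) := by
  have hBs : ∀ s : ℕ, MeasurableSet[history S.arm s] (B ∩ {ω | σ ω = (s : ℕ∞)}) := fun s =>
    (hσ.measurableSet_inter_eq_iff B s).1 (hB.inter (hσ.measurableSet_eq' s))
  have B_eq_iUnion : B = ⋃ s : ℕ, B ∩ {ω | σ ω = (s : ℕ∞)} := by
    rw [← inter_iUnion, eq_comm, inter_eq_left]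
    intro ω _
    obtain ⟨s, hs⟩ := ENat.ne_top_iff_exists.1 (hσ_top ω)
    exact mem_iUnion.2 ⟨s, hs.symm⟩
  have disjoint_stop : Pairwise (Function.onFun Disjoint fun s : ℕ => B ∩ {ω | σ ω = (s : ℕ∞)}) :=
    fun s t hst => Set.disjoint_left.2 fun ω hs ht =>
      hst (ENat.natCast_inj.1 (hs.2.symm.trans ht.2))
  rw [B_eq_iUnion, measure_iUnion disjoint_stop fun s => S.history_le s _ (hBs s),
    lintegral_iUnion (fun s => S.history_le s _ (hBs s)) disjoint_stop]
  refine tsum_congr fun s => ?_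
  rw [S.obsLaw_apply_eq_setLIntegral hm hn s (hBs s)]
  refine setLIntegral_congr_fun (S.history_le s _ (hBs s)) fun ω hω => ?_
  simp only [stoppedValue, show σ ω = s from hω.2]
  rfl

theorem integrable_exp_stoppedValue_logLik (hm : ∀ i, μ i ∈ E.means) (hn : ∀ i, ν i ∈ E.means)
    (hσ : IsStoppingTime S.filtration σ) (hσn : ∀ ω, σ ω ≤ n) :
    Integrable (fun ω => Real.exp (stoppedValue (S.logLik E μ ν) σ ω)) (obsLaw E μ) := by
  have := isProbabilityMeasure_obsLaw hn
  refine ⟨Real.continuous_exp.comp_aestronglyMeasurable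
    (integrable_stoppedValue_logLik hm ν hσ hσn).aestronglyMeasurable, ?_⟩
  rw [hasFiniteIntegral_iff_ofReal (Filter.Eventually.of_forall fun _ => (Real.exp_pos _).le),
    ← setLIntegral_univ, ← obsLaw_apply_eq_setLIntegral_stoppedValue hm hn hσ
      (fun ω => ne_top_of_le_ne_top (ENat.natCast_ne_top n) (hσn ω)) MeasurableSet.univ]
  exact measure_lt_top _ _

theorem setIntegral_exp_stoppedValue_logLik (hm : ∀ i, μ i ∈ E.means) (hn : ∀ i, ν i ∈ E.means)
    (hσ : IsStoppingTime S.filtration σ) (hσn : ∀ ω, σ ω ≤ n) {B : Set (Obs K)}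
    (hB : MeasurableSet[hσ.measurableSpace] B) :
    ∫ ω in B, Real.exp (stoppedValue (S.logLik E μ ν) σ ω) ∂(obsLaw E μ) =
      (obsLaw E ν).real B := by
  rw [integral_eq_lintegral_of_nonneg_ae (Filter.Eventually.of_forall fun _ => (Real.exp_pos _).le)
    (integrable_exp_stoppedValue_logLik hm hn hσ hσn).aestronglyMeasurable.restrict,
    ← obsLaw_apply_eq_setLIntegral_stoppedValue hm hn hσ
      (fun ω => ne_top_of_le_ne_top (ENat.natCast_ne_top n) (hσn ω)) hB, Measure.real]

theorem log_mul_le_sum_expectedCount (hm : ∀ i, μ i ∈ E.means) (hn : ∀ i, ν i ∈ E.means)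
    (hσ : IsStoppingTime S.filtration σ) (hσn : ∀ ω, σ ω ≤ n) {B : Set (Obs K)}
    (hB : MeasurableSet[hσ.measurableSpace] B) {δ : ℝ} (hδ : 0 < δ) (hδ2 : δ ≤ 1 / 2)
    (hBδ : (obsLaw E ν).real B ≤ δ) :
    Real.log ((1 - δ) / δ) * (2 * (obsLaw E μ).real B - 1) ≤
      ∑ j, S.expectedCount E μ σ n j * E.d (μ j) (ν j) := by
  have := isProbabilityMeasure_obsLaw hm
  have := isProbabilityMeasure_obsLaw hn
  have integral_exp_eq_one :
      ∫ ω, Real.exp (stoppedValue (S.logLik E μ ν) σ ω) ∂(obsLaw E μ) = 1 := by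
    rw [← setIntegral_univ, setIntegral_exp_stoppedValue_logLik hm hn hσ hσn MeasurableSet.univ,
      probReal_univ]
  rw [← neg_eq_iff_eq_neg.2 (integral_stoppedValue_logLik hm hn hσ hσn)]
  exact log_mul_two_mul_measureReal_sub_one_le (integrable_stoppedValue_logLik hm ν hσ hσn)
    (integrable_exp_stoppedValue_logLik hm hn hσ hσn) integral_exp_eq_one
    (hσ.measurableSpace_le _ hB) hδ hδ2
    ((setIntegral_exp_stoppedValue_logLik hm hn hσ hσn hB).trans_le hBδ)

end Stopped

end SamplingRule

/-! ### The lower bound on the expected time -/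

theorem dB_one_sub (δ : ℝ) : dB δ (1 - δ) = (1 - 2 * δ) * Real.log ((1 - δ) / δ) := by
  have log_inv_ratio : Real.log (δ / (1 - δ)) = -Real.log ((1 - δ) / δ) := by
    rw [← Real.log_inv, inv_div]
  rw [dB, sub_sub_cancel, log_inv_ratio]
  ring

theorem sum_range_ite_lt_le (n : ℕ) (t : ℕ∞) :
    ∑ s ∈ Finset.range n, (if (s : ℕ∞) < t then (1 : ℝ≥0∞) else 0) ≤ t := by
  rw [Finset.sum_boole]
  cases t with
  | top => simp
  | coe m =>
    rw [ENat.toENNReal_coe, Nat.cast_le]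
    refine (Finset.card_le_card fun s hs => Finset.mem_range.2 ?_).trans_eq (Finset.card_range m)
    exact_mod_cast (Finset.mem_filter.1 hs).2

section ExpectedTime

variable {K : ℕ} {E : ExpFamily} {μ : Fin K → ℝ}

namespace SamplingRule

variable {S : SamplingRule K} {σ : Obs K → ℕ∞}

theorem sum_expectedCount (hm : ∀ i, μ i ∈ E.means) (hσ : IsStoppingTime S.filtration σ) (n : ℕ) :
    ∑ j, S.expectedCount E μ σ n j =
      ∑ s ∈ Finset.range n, (obsLaw E μ).real {ω | (s : ℕ∞) < σ ω} := by
  have := isProbabilityMeasure_obsLaw hm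
  unfold expectedCount
  rw [Finset.sum_comm]
  refine Finset.sum_congr rfl fun s _ => ?_
  rw [← measureReal_biUnion_finset]
  · congr 1
    ext ω
    simp
  · exact fun i _ j _ hij => Set.disjoint_left.2 fun ω hi hj => hij (hi.2.symm.trans hj.2)
  · exact fun j _ => S.history_le s _
      ((measurableSet_lt_stop hσ s).inter (S.measurableSet_arm_eq s j))

theorem ofReal_sum_expectedCount_le (hm : ∀ i, μ i ∈ E.means)
    (hσ : IsStoppingTime S.filtration σ) (n : ℕ) :
    ENNReal.ofReal (∑ j, S.expectedCount E μ σ n j) ≤ ∫⁻ ω, (σ ω : ℝ≥0∞) ∂(obsLaw E μ) := by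
  have := isProbabilityMeasure_obsLaw hm
  have hlt : ∀ s : ℕ, MeasurableSet {ω | (s : ℕ∞) < σ ω} := fun s =>
    S.history_le s _ (measurableSet_lt_stop hσ s)
  rw [sum_expectedCount hm hσ, ENNReal.ofReal_sum_of_nonneg fun _ _ => measureReal_nonneg]
  calc ∑ s ∈ Finset.range n, ENNReal.ofReal ((obsLaw E μ).real {ω | (s : ℕ∞) < σ ω})
      = ∑ s ∈ Finset.range n,
          ∫⁻ ω, {ω | (s : ℕ∞) < σ ω}.indicator (1 : Obs K → ℝ≥0∞) ω ∂(obsLaw E μ) :=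
        Finset.sum_congr rfl fun s _ => by
          rw [lintegral_indicator_one (hlt s), ofReal_measureReal]
    _ = ∫⁻ ω, ∑ s ∈ Finset.range n,
          {ω | (s : ℕ∞) < σ ω}.indicator (1 : Obs K → ℝ≥0∞) ω ∂(obsLaw E μ) :=
        (lintegral_finsetSum _ fun s _ => measurable_one.indicator (hlt s)).symm
    _ ≤ ∫⁻ ω, (σ ω : ℝ≥0∞) ∂(obsLaw E μ) := lintegral_mono fun ω => by
        simpa only [indicator_apply, mem_ofPred_eq, Pi.one_apply]
          using sum_range_ite_lt_le n (σ ω)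

end SamplingRule

end ExpectedTime

section LowerBound

open Filter Topology

variable {K : ℕ} {E : ExpFamily} {γ δ : ℝ} {μ ν : Fin K → ℝ} {k : Fin K} {A : Algorithm K}

theorem correct_eq_singleton (hμ : μ ∈ instances E γ) (hk : IsPackingSlice γ μ k) :
    correct γ μ = {k.succ} := by
  refine eq_singleton_iff_unique_mem.2 ⟨succ_mem_correct.2 hk, ?_⟩
  rintro a (⟨-, unavailable⟩ | ⟨i, rfl, hi⟩)
  · exact absurd hk.1 (not_lt.2 (unavailable k))
  · rw [hμ.2.2 i k hi hk]

namespace Algorithm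

theorem measurableSet_decision_eq (A : Algorithm K) (a : Fin (K + 1)) :
    MeasurableSet[A.isStoppingTime.measurableSpace] {ω | A.decision ω = a} :=
  A.measurable_decision (t := {a}) trivial

theorem measurableSet_decision_eq_inter_le (A : Algorithm K) (a : Fin (K + 1)) (n : ℕ) :
    MeasurableSet[(A.isStoppingTime.min_const n).measurableSpace]
      ({ω | A.decision ω = a} ∩ {ω | A.τ ω ≤ n}) :=
  (A.isStoppingTime.measurableSet_inter_le_const_iff _ n).1
    ((A.measurableSet_decision_eq a).inter (A.isStoppingTime.measurableSet_le' n))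

theorem IsPC.one_sub_le_measureReal_decision (hA : A.IsPC E γ δ) (hδ : 0 ≤ δ)
    (hμ : μ ∈ instances E γ) (hk : IsPackingSlice γ μ k) :
    1 - δ ≤ (obsLaw E μ).real {ω | A.decision ω = k.succ} := by
  have := isProbabilityMeasure_obsLaw hμ.1
  have wrong_eq_compl :
      {ω | A.decision ω ∉ correct γ μ} = {ω | A.decision ω = k.succ}ᶜ := by
    rw [correct_eq_singleton hμ hk]
    rfl
  have wrong_le : (obsLaw E μ).real {ω | A.decision ω = k.succ}ᶜ ≤ δ :=
    ENNReal.toReal_le_of_le_ofReal hδ (wrong_eq_compl ▸ (hA μ hμ).2)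
  rw [probReal_compl_eq_one_sub (A.isStoppingTime.measurableSpace_le _
    (A.measurableSet_decision_eq _))] at wrong_le
  exact sub_le_comm.1 wrong_le

theorem IsPC.measureReal_decision_le (hA : A.IsPC E γ δ) (hδ : 0 ≤ δ) {a : Fin (K + 1)}
    (hν : ν ∈ alt E γ a) : (obsLaw E ν).real {ω | A.decision ω = a} ≤ δ := by
  refine ENNReal.toReal_le_of_le_ofReal hδ ((measure_mono ?_).trans (hA ν hν.1).2)
  rintro ω rfl
  exact hν.2

theorem IsPC.tendsto_measureReal_inter_le (hA : A.IsPC E γ δ) (hμ : μ ∈ instances E γ)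
    (D : Set (Obs K)) :
    Tendsto (fun n : ℕ => (obsLaw E μ).real (D ∩ {ω | A.τ ω ≤ n})) atTop
      (𝓝 ((obsLaw E μ).real D)) := by
  have := isProbabilityMeasure_obsLaw hμ.1
  have mono_event : Monotone fun n : ℕ => D ∩ {ω | A.τ ω ≤ n} := fun m n hmn =>
    inter_subset_inter_right _ fun ω (hω : A.τ ω ≤ m) => hω.trans (Nat.cast_le.2 hmn)
  have iUnion_ae_eq : (⋃ n : ℕ, D ∩ {ω | A.τ ω ≤ n} : Set (Obs K)) =ᵐ[obsLaw E μ] D := by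
    rw [← inter_iUnion]
    refine inter_ae_eq_left_of_ae_eq_univ (eventuallyEq_univ.2 ?_)
    filter_upwards [(hA μ hμ).1] with ω hω
    obtain ⟨m, hm⟩ := ENat.ne_top_iff_exists.1 hω.ne
    exact mem_iUnion.2 ⟨m, hm.ge⟩
  have tendsto_iUnion := tendsto_measure_iUnion_atTop (μ := obsLaw E μ) mono_event
  rw [measure_congr iUnion_ae_eq] at tendsto_iUnion
  exact (ENNReal.tendsto_toReal (measure_ne_top _ _)).comp tendsto_iUnion

theorem IsPC.T2_mul_log_mul_le_expectedTime (hA : A.IsPC E γ δ) (hγ : γ ∈ E.means)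
    (hμ : μ ∈ instances E γ) (hk : IsPackingSlice γ μ k) (hδ : 0 < δ) (hδ2 : δ ≤ 1 / 2) (n : ℕ) :
    ENNReal.ofReal (T2 E γ μ k * (Real.log ((1 - δ) / δ) *
      (2 * (obsLaw E μ).real ({ω | A.decision ω = k.succ} ∩ {ω | A.τ ω ≤ n}) - 1))) ≤
      A.expectedTime E μ := by
  have hσ := A.isStoppingTime.min_const n
  calc _ ≤ ENNReal.ofReal (∑ j, A.expectedCount E μ (fun ω => min (A.τ ω) n) n j) := by
        refine ENNReal.ofReal_le_ofReal (T2_mul_le_sum hγ hμ hk (forall_mem_image.2 fun ν hν => ?_))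
        have := isProbabilityMeasure_obsLaw hν.1.1
        exact SamplingRule.log_mul_le_sum_expectedCount hμ.1 hν.1.1 hσ (fun _ => min_le_right _ _)
          (A.measurableSet_decision_eq_inter_le k.succ n) hδ hδ2
          ((measureReal_mono inter_subset_left).trans (hA.measureReal_decision_le hδ.le hν))
    _ ≤ ∫⁻ ω, ((min (A.τ ω) n : ℕ∞) : ℝ≥0∞) ∂(obsLaw E μ) :=
        SamplingRule.ofReal_sum_expectedCount_le hμ.1 hσ n
    _ ≤ A.expectedTime E μ :=
        lintegral_mono fun ω => ENat.toENNReal_le.2 (min_le_left _ _)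

theorem IsPC.T2_mul_dB_le_expectedTime (hA : A.IsPC E γ δ) (hγ : γ ∈ E.means)
    (hμ : μ ∈ instances E γ) (hk : IsPackingSlice γ μ k) (hδ : 0 < δ) (hδ2 : δ ≤ 1 / 2) :
    ENNReal.ofReal (T2 E γ μ k * dB δ (1 - δ)) ≤ A.expectedTime E μ := by
  have log_nonneg : 0 ≤ Real.log ((1 - δ) / δ) := by
    refine Real.log_nonneg ?_
    rw [le_div_iff₀ hδ]
    linarith
  have tendsto_bound := ENNReal.tendsto_ofReal
    ((((hA.tendsto_measureReal_inter_le hμ {ω | A.decision ω = k.succ}).const_mul 2).sub_const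
      1).const_mul (Real.log ((1 - δ) / δ)) |>.const_mul (T2 E γ μ k))
  refine le_trans (ENNReal.ofReal_le_ofReal ?_) (le_of_tendsto' tendsto_bound
    (hA.T2_mul_log_mul_le_expectedTime hγ hμ hk hδ hδ2))
  have decision_ge := hA.one_sub_le_measureReal_decision hδ.le hμ hk
  rw [dB_one_sub, mul_comm (1 - 2 * δ)]
  exact mul_le_mul_of_nonneg_left (mul_le_mul_of_nonneg_left (by linarith) log_nonneg)
    (T2_pos hγ hμ hk).le

end Algorithm

end LowerBound

end Slicing

end

theorem proposition3 {K : ℕ} (E : Slicing.ExpFamily) (γ : ℝ) (hγ : γ ∈ E.means)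
    (μ : Fin K → ℝ) (hμ : μ ∈ Slicing.instances E γ)
    (k : Fin K) (hk : Slicing.IsPackingSlice γ μ k) :
    -- `y*` and `z*` are well defined
    ((Slicing.lessLoaded μ k).Nonempty → ∃! y : ℝ, Slicing.IsEquilibrium E μ k y) ∧
    0 < Slicing.zStar E γ μ k ∧
    (∀ j ∈ Slicing.lessLoaded μ k, Slicing.zStar E γ μ k ∈ Slicing.gRange E μ j k) ∧
    -- the lower bound on the expected number of measurements
    (∀ δ : ℝ, 0 < δ → δ ≤ 1 / 2 → ∀ A : Slicing.Algorithm K, A.IsPC E γ δ →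
      ENNReal.ofReal (Slicing.T2 E γ μ k * Slicing.dB δ (1 - δ)) ≤ A.expectedTime E μ) ∧
    -- the proportions `w*` are the unique optimal ones, and the optimal rate is `1 / T₂(μ)`
    {w : Fin K → ℝ | w ∈ stdSimplex ℝ (Fin K) ∧
      IsMaxOn (Slicing.rate E γ μ k.succ) (stdSimplex ℝ (Fin K)) w} =
        {Slicing.wStar E γ μ k} ∧
    Slicing.rate E γ μ k.succ (Slicing.wStar E γ μ k) = (Slicing.T2 E γ μ k)⁻¹ := by
  refine ⟨Slicing.existsUnique_isEquilibrium hμ.1, ?_, fun j hj => ?_, fun δ hδ hδ2 A hA => ?_,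
    Slicing.setOf_isMaxOn_rate hγ hμ hk, Slicing.rate_wStar hγ hμ hk⟩
  · exact Slicing.zStar_pos hγ hμ.1 hk.1.ne
  · exact Slicing.zStar_mem_gRange hγ hμ.1 hk.1.ne hj
  · exact hA.T2_mul_dB_le_expectedTime hγ hμ hk hδ hδ2
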